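/- Let $(\rho_i)_{i\ge 1}$ be a sequence in $(0,1)$ with $\rho_i<\rho$ for all $i$ and some fixed $\rho<1$. Let $P=(p_i)_{i\ge1}$ and $Q=(q_j)_{j\ge1}$ be probability vectors with finite entropy, $-\sum_i p_i\log p_i<\infty$ and $-\sum_j q_j\log q_j<\infty$ (with $0\log 0=0$). Let $\Lambda=\{1,2,\dots\}^{\mathbb Z}$ with the shift $\theta$ and the two-sided Bernoulli measure $m_P$, let $E=\{1,2,\dots\}$, and let $E^\infty=\{(\omega_1,\omega_2,\dots):\omega_i\in E\}$ carry the shift and the one-sided Bernoulli measure $\nu_Q$. Put $\mu=m_P\times\nu_Q$ and let $(\mu_\lambda)_{\lambda\in\Lambda}$ be its disintegration into probability measures on $E^\infty$ over $\Lambda$. Consider the random infinite iterated function system $$\varphi_n^\lambda(x)=\rho_{\lambda_n}x+(-1)^{\lambda_0}\qquad(n\ge1,\ \lambda\in\Lambda)$$ on a compact interval $X=[a,b]$, $a<b$, which all the maps $\varphi^\lambda_n$ send into itself, and let $\pi_\lambda(\omega)$ be the unique point of $\bigcap_{n\ge1}\varphi^{\lambda}_{\omega_1}\circ\varphi^{\theta(\lambda)}_{\omega_2}\circ\dots\circ\varphi^{\theta^{n-1}(\lambda)}_{\omega_n}(X)$.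 Then there is a number $d\ge0$ such that: 1. For $m_P$-almost every $\lambda$, the measure $\mu_\lambda\circ\pi_\lambda^{-1}$ is exact dimensional with dimension $d$, i.e. $\lim_{r\to0}\frac{\log \mu_\lambda\circ\pi_\lambda^{-1}(B(x,r))}{\log r}=d$ for $\mu_\lambda\circ\pi_\lambda^{-1}$-almost every $x$; moreover its Hausdorff and packing dimensions exist and are equal to $d$. (The Hausdorff dimension of a finite Borel measure $\nu$ exists and equals $d$ if $\inf\{\mathrm{HD}(Y):\nu(Y)>0\}=\inf\{\mathrm{HD}(Y):\nu(Y^c)=0\}=d$, with $Y$ ranging over Borel sets; similarly for packing dimension.) 2. For $\mu$-almost every $(\lambda,\omega)$, the pointwise dimension of $\mu_\lambda\circ\pi_\lambda^{-1}$ at $\pi_\lambda(\omega)$ exists and equals $d$. 3. The number $d$ satisfies $$d\le\frac{\sum_{i\ge1}p_i\log p_i+\sum_{j\ge1}q_j\log q_j}{\sum_{j\ge1}p_j\log\rho_j},$$ where the right-hand side is read as $0$ (so that $d=0$) if $\sum_{j}p_j\log\rho_j=-\infty$. -/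

import Mathlib

open MeasureTheory ProbabilityTheory Filter Topology Set
open scoped NNReal ENNReal

namespace RandomIFS

noncomputable section

/-! ### Pointwise, Hausdorff and packing dimensions of measures -/

/-- The pointwise dimension `lim_{r → 0} log μ(B(x, r)) / log r` exists and equals `d`. -/
def HasPointwiseDim {X : Type*} [PseudoMetricSpace X] [MeasurableSpace X]
    (μ : Measure X) (x : X) (d : ℝ) : Prop :=
  Tendsto (fun r : ℝ => Real.log (μ.real (Metric.ball x r)) / Real.log r) (𝓝[>] 0) (𝓝 d)

/-- `μ` is a finite measure which is exact dimensional, with a.e. pointwise dimension `d`. -/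
def IsExactDimensional {X : Type*} [PseudoMetricSpace X] [MeasurableSpace X]
    (μ : Measure X) (d : ℝ) : Prop :=
  IsFiniteMeasure μ ∧ ∀ᵐ x ∂μ, HasPointwiseDim μ x d

/-- `HD_⋆(μ)` and `PD_⋆(μ)`, when `dim` is the Hausdorff, resp. the packing dimension of sets. -/
def lowerDim {X : Type*} [MeasurableSpace X] (dim : Set X → ℝ≥0∞) (μ : Measure X) : ℝ≥0∞ :=
  ⨅ (Y : Set X) (_ : MeasurableSet Y) (_ : 0 < μ Y), dim Y

/-- `HD^⋆(μ)` and `PD^⋆(μ)`, when `dim` is the Hausdorff, resp. the packing dimension of sets. -/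
def upperDim {X : Type*} [MeasurableSpace X] (dim : Set X → ℝ≥0∞) (μ : Measure X) : ℝ≥0∞ :=
  ⨅ (Y : Set X) (_ : MeasurableSet Y) (_ : μ Yᶜ = 0), dim Y

/-- The set of `δ`-packings of `A`: finite families of pairwise disjoint closed balls with centres
in `A` and positive radii at most `δ`, given by the finset of centres and the radius function. -/
def IsPacking {X : Type*} [PseudoMetricSpace X] (A : Set X) (δ : ℝ) (t : Finset X) (r : X → ℝ) :
    Prop :=
  (t : Set X) ⊆ A ∧ (∀ x ∈ t, 0 < r x ∧ r x ≤ δ) ∧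
    (t : Set X).PairwiseDisjoint (fun x => Metric.closedBall x (r x))

/-- The `s`-dimensional packing premeasure
`lim_{δ → 0} sup { ∑ (2 rᵢ)^s : (B(xᵢ, rᵢ)) a δ-packing of A }`. -/
def packingPremeasure {X : Type*} [PseudoMetricSpace X] (s : ℝ≥0) (A : Set X) : ℝ≥0∞ :=
  ⨅ (δ : ℝ) (_ : 0 < δ), ⨆ (t : Finset X) (r : X → ℝ) (_ : IsPacking A δ t r),
    ∑ x ∈ t, ENNReal.ofReal (2 * r x) ^ (s : ℝ)

/-- The `s`-dimensional packing measure. -/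
def packingMeasure {X : Type*} [PseudoMetricSpace X] (s : ℝ≥0) (A : Set X) : ℝ≥0∞ :=
  ⨅ (c : ℕ → Set X) (_ : A ⊆ ⋃ i, c i), ∑' i, packingPremeasure s (c i)

/-- The packing dimension of a set. -/
def dimP {X : Type*} [PseudoMetricSpace X] (A : Set X) : ℝ≥0∞ :=
  ⨅ (s : ℝ≥0) (_ : packingMeasure s A = 0), (s : ℝ≥0∞)

/-- The Hausdorff dimension of the measure `μ` exists and equals `d`. -/
def HasHausdorffDim {X : Type*} [MetricSpace X] [MeasurableSpace X] (μ : Measure X) (d : ℝ≥0∞) :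
    Prop :=
  lowerDim dimH μ = d ∧ upperDim dimH μ = d

/-- The packing dimension of the measure `μ` exists and equals `d`. -/
def HasPackingDim {X : Type*} [MetricSpace X] [MeasurableSpace X] (μ : Measure X) (d : ℝ≥0∞) :
    Prop :=
  lowerDim dimP μ = d ∧ upperDim dimP μ = d

/-! ### The symbol spaces and Bernoulli measures -/

instance instMeasurableSpacePNat : MeasurableSpace ℕ+ := ⊤

instance instDiscreteMeasurableSpacePNat : DiscreteMeasurableSpace ℕ+ := ⟨fun _ => trivial⟩

/-- The parameter space `Λ = {1, 2, …}^ℤ`. -/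
abbrev Param : Type := ℤ → ℕ+

/-- The one-sided sequences over `E = {1, 2, …}`; `w k` is the letter `ω_{k+1}`. -/
abbrev Code : Type := ℕ → ℕ+

/-- The shift homeomorphism `θ` of `Λ`. -/
def theta (l : Param) : Param := fun i => l (i + 1)

/-- The one-sided shift `σ`. -/
def sigma (w : Code) : Code := fun k => w (k + 1)

/-- The two-sided Bernoulli measure `m_P`. -/
def bernoulliTwoSided (p : PMF ℕ+) : Measure Param :=
  Measure.infinitePi (fun _ : ℤ => p.toMeasure)

/-- The one-sided Bernoulli measure `ν_Q`. -/
def bernoulliOneSided (q : PMF ℕ+) : Measure Code :=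
  Measure.infinitePi (fun _ : ℕ => q.toMeasure)

/-! ### The random system -/

/-- The contraction `φ_n^λ(x) = ρ_{λ_n} x + (-1)^{λ_0}`. -/
def contraction (ρ : ℕ+ → ℝ) (l : Param) (n : ℕ+) (x : ℝ) : ℝ :=
  ρ (l ((n : ℕ) : ℤ)) * x + (-1) ^ ((l 0 : ℕ+) : ℕ)

/-- `φ_{ω|n}^λ = φ_{ω_1}^λ ∘ φ_{ω_2}^{θ(λ)} ∘ ⋯ ∘ φ_{ω_n}^{θ^{n-1}(λ)}`. -/
def wordMap (ρ : ℕ+ → ℝ) : ℕ → Param → Code → ℝ → ℝ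
  | 0, _, _ => id
  | n + 1, l, w => contraction ρ l (w 0) ∘ wordMap ρ n (theta l) (sigma w)

/-- The projection `π_λ(ω)`, the point of `⋂_{n ≥ 1} φ_{ω|n}^λ(X)`; see `iInter_eq_singleton`. -/
def proj (ρ : ℕ+ → ℝ) (X : Set ℝ) (l : Param) (w : Code) : ℝ :=
  Classical.epsilon (fun x => x ∈ ⋂ n : ℕ, wordMap ρ (n + 1) l w '' X)

theorem continuous_wordMap (ρ : ℕ+ → ℝ) (n : ℕ) (l : Param) (w : Code) :
    Continuous (wordMap ρ n l w) := by
  induction n generalizing l w with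
  | zero => exact continuous_id
  | succ n ih =>
    refine Continuous.comp ?_ (ih _ _)
    unfold contraction
    fun_prop

theorem mapsTo_wordMap {ρ : ℕ+ → ℝ} {X : Set ℝ} (hX : ∀ l n, MapsTo (contraction ρ l n) X X)
    (n : ℕ) (l : Param) (w : Code) : MapsTo (wordMap ρ n l w) X X := by
  induction n generalizing l w with
  | zero => exact mapsTo_id X
  | succ n ih => exact (hX _ _).comp (ih _ _)

theorem image_wordMap_succ_subset {ρ : ℕ+ → ℝ} {X : Set ℝ}
    (hX : ∀ l n, MapsTo (contraction ρ l n) X X) (n : ℕ) (l : Param) (w : Code) :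
    wordMap ρ (n + 1) l w '' X ⊆ wordMap ρ n l w '' X := by
  induction n generalizing l w with
  | zero =>
    simpa [wordMap] using (hX l (w 0)).image_subset
  | succ n ih =>
    have h1 : wordMap ρ (n + 1 + 1) l w '' X
        = contraction ρ l (w 0) '' (wordMap ρ (n + 1) (theta l) (sigma w) '' X) := by
      rw [← image_comp]; rfl
    have h2 : wordMap ρ (n + 1) l w '' X
        = contraction ρ l (w 0) '' (wordMap ρ n (theta l) (sigma w) '' X) := by
      rw [← image_comp]; rfl
    rw [h1, h2]
    exact image_mono (ih _ _)

theorem abs_wordMap_sub_le {ρ : ℕ+ → ℝ} {r : ℝ} (hρ : ∀ i, 0 < ρ i ∧ ρ i < r)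
    (n : ℕ) (l : Param) (w : Code) (x y : ℝ) :
    |wordMap ρ n l w x - wordMap ρ n l w y| ≤ r ^ n * |x - y| := by
  induction n generalizing l w with
  | zero => simp [wordMap]
  | succ n ih =>
    have h : wordMap ρ (n + 1) l w x - wordMap ρ (n + 1) l w y
        = ρ (l ((w 0 : ℕ) : ℤ)) * (wordMap ρ n (theta l) (sigma w) x
          - wordMap ρ n (theta l) (sigma w) y) := by
      simp only [wordMap, contraction, Function.comp]; ring
    have hi := hρ (l ((w 0 : ℕ) : ℤ))
    rw [h, abs_mul, abs_of_pos hi.1, pow_succ', mul_assoc]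
    exact mul_le_mul hi.2.le (ih _ _) (abs_nonneg _) (hi.1.trans hi.2).le

/-- The sets `φ_{ω|n}^λ(X)` shrink to the single point `π_λ(ω)`. -/
theorem iInter_eq_singleton {ρ : ℕ+ → ℝ} {r : ℝ} (hr : r < 1) (hρ : ∀ i, 0 < ρ i ∧ ρ i < r)
    {X : Set ℝ} (hc : IsCompact X) (hne : X.Nonempty)
    (hX : ∀ l n, MapsTo (contraction ρ l n) X X) (l : Param) (w : Code) :
    ⋂ n : ℕ, wordMap ρ (n + 1) l w '' X = {proj ρ X l w} := by
  have hr0 : 0 < r := (hρ 1).1.trans (hρ 1).2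
  have hcomp : ∀ n, IsCompact (wordMap ρ (n + 1) l w '' X) := fun n =>
    hc.image (continuous_wordMap ρ _ l w)
  have hn : (⋂ n : ℕ, wordMap ρ (n + 1) l w '' X).Nonempty :=
    IsCompact.nonempty_iInter_of_sequence_nonempty_isCompact_isClosed _
      (fun n => image_wordMap_succ_subset hX _ l w) (fun n => hne.image _) (hcomp 0)
      (fun n => (hcomp n).isClosed)
  have hmem : proj ρ X l w ∈ ⋂ n : ℕ, wordMap ρ (n + 1) l w '' X :=
    Classical.epsilon_spec (p := fun x => x ∈ ⋂ n : ℕ, wordMap ρ (n + 1) l w '' X) hn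
  obtain ⟨C, hC⟩ := hc.isBounded.exists_norm_le
  refine Subset.antisymm (fun y hy => ?_) (singleton_subset_iff.2 hmem)
  have hbound : ∀ n : ℕ, |y - proj ρ X l w| ≤ r ^ (n + 1) * (2 * C) := by
    intro n
    obtain ⟨a, ha, rfl⟩ := mem_iInter.1 hy n
    obtain ⟨b, hb, hb'⟩ := mem_iInter.1 hmem n
    rw [← hb']
    refine (abs_wordMap_sub_le hρ _ l w a b).trans ?_
    have h1 := hC a ha
    have h2 := hC b hb
    have h3 : |a - b| ≤ |a| + |b| := abs_sub a b
    rw [Real.norm_eq_abs] at h1 h2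
    exact mul_le_mul_of_nonneg_left (by linarith) (by positivity)
  have hlim : Tendsto (fun n : ℕ => r ^ (n + 1) * (2 * C)) atTop (𝓝 0) := by
    have := ((tendsto_pow_atTop_nhds_zero_of_lt_one hr0.le hr).comp
      (tendsto_add_atTop_nat 1)).mul_const (2 * C)
    simpa using this
  have h0 : |y - proj ρ X l w| ≤ 0 := ge_of_tendsto' hlim hbound
  exact mem_singleton_iff.2 (sub_eq_zero.1 (abs_nonpos_iff.1 h0))

theorem measurable_wordMap (ρ : ℕ+ → ℝ) (n : ℕ) (l : Param) (x : ℝ) :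
    Measurable (fun w : Code => wordMap ρ n l w x) := by
  induction n generalizing l with
  | zero => exact measurable_const
  | succ n ih =>
    have hs : Measurable sigma := measurable_pi_lambda _ fun k => measurable_pi_apply (k + 1)
    have h1 : Measurable fun w : Code => ρ (l ((w 0 : ℕ) : ℤ)) :=
      (measurable_from_top (f := fun i : ℕ+ => ρ (l ((i : ℕ) : ℤ)))).comp (measurable_pi_apply 0)
    exact (h1.mul ((ih (theta l)).comp hs)).add_const _

/-- Measurability of `π_λ`, so that the image measure `μ_λ ∘ π_λ⁻¹` is the genuine one. -/
theorem measurable_proj {ρ : ℕ+ → ℝ} {r : ℝ} (hr : r < 1) (hρ : ∀ i, 0 < ρ i ∧ ρ i < r)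
    {X : Set ℝ} (hc : IsCompact X) (hne : X.Nonempty)
    (hX : ∀ l n, MapsTo (contraction ρ l n) X X) (l : Param) : Measurable (proj ρ X l) := by
  have hr0 : 0 < r := (hρ 1).1.trans (hρ 1).2
  obtain ⟨x, hx⟩ := hne
  obtain ⟨C, hC⟩ := hc.isBounded.exists_norm_le
  refine measurable_of_tendsto_metrizable (f := fun n w => wordMap ρ (n + 1) l w x)
    (fun n => measurable_wordMap ρ _ l x) (tendsto_pi_nhds.2 fun w => ?_)
  have hmem : proj ρ X l w ∈ ⋂ n : ℕ, wordMap ρ (n + 1) l w '' X := by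
    rw [iInter_eq_singleton hr hρ hc ⟨x, hx⟩ hX l w]; exact mem_singleton _
  have hlim : Tendsto (fun n : ℕ => r ^ (n + 1) * (2 * C)) atTop (𝓝 0) := by
    have := ((tendsto_pow_atTop_nhds_zero_of_lt_one hr0.le hr).comp
      (tendsto_add_atTop_nat 1)).mul_const (2 * C)
    simpa using this
  refine tendsto_iff_dist_tendsto_zero.2 (squeeze_zero (fun _ => dist_nonneg) (fun n => ?_) hlim)
  obtain ⟨b, hb, hb'⟩ := mem_iInter.1 hmem n
  rw [← hb', Real.dist_eq]
  refine (abs_wordMap_sub_le hρ _ l w x b).trans ?_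
  have h1 := hC x hx
  have h2 := hC b hb
  have h3 : |x - b| ≤ |x| + |b| := abs_sub x b
  rw [Real.norm_eq_abs] at h1 h2
  exact mul_le_mul_of_nonneg_left (by linarith) (by positivity)

end

end RandomIFS

/-! Only the coordinates of `λ` with nonnegative index enter `π_λ`, and the disintegration of a
product measure is almost everywhere the constant `ν_Q`. The problem is therefore about the skew
product of two one-sided Bernoulli shifts, which is ergodic by Kolmogorov's zero-one law, and about
the laws `ν_l` of `ω ↦ π_l(ω)`.

Let `R_n(z)` be `b - a` times the product of the first `n` contraction ratios along `z = (l, ω)`,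
and let `G_n(z)` be the `ν_l`-mass of the closed ball of radius `R_n(z)` about `π_l(ω)`. Since each
map is a similarity and the letters of `ω` are independent, the part of `ν_l` carried by codes with
first letter `ω_1` gives the ball of radius `R_{n+1}(z)` exactly the mass `q_{ω_1} G_n(skew z)`
(`cellMeasure_closedBall`). Hence `log G_{n+1}(z) = log q_{ω_1} + log G_n(skew z) + F_n(z)`, where
`F_n` (`ballInfo`) is the logarithm of the ratio of the full mass to the cell mass of that ball.
Iterating, `log G_n` is a Birkhoff sum of `log q_{ω_1}` plus the sum of `F_{n-k-1}` along the orbit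
(`log_ballMass_eq`).

The functions `F_n` are almost everywhere nonnegative, converge almost everywhere by Besicovitch
differentiation, and have an integrable supremum: the Besicovitch maximal inequality gives
exponential tails on each cell, and finite entropy of `Q` makes the cell bounds summable
(`lintegral_iSup_ballInfo_lt_top`). Maker's theorem then yields `-log G_n / n → h` with `0 ≤ h ≤
H(Q)`. Birkhoff's theorem gives `-log R_n / n → χ = -∑ p_j log ρ_j`, possibly infinite, because
`λ_{ω_1}` has law `P`. Sandwiching an arbitrary radius between consecutive `R_n` gives pointwise
dimension `h / χ`, read as `0` if `χ = ∞`. The stated bound follows from `h ≤ H(Q) ≤ H(P) + H(Q)`.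
Hausdorff and packing dimensions are then determined by the pointwise dimension. -/

namespace RandomIFS

/-! ### The pointwise ergodic theorem -/

section Ergodic

variable {α : Type*} {T : α → α} {f : α → ℝ}

/-- The maximum of the Birkhoff sums of order at most `n`. -/
def birkhoffMax (T : α → α) (f : α → ℝ) : ℕ → α → ℝ
  | 0, _ => 0
  | n + 1, x => max 0 (f x + birkhoffMax T f n (T x))

theorem birkhoffMax_nonneg (n : ℕ) (x : α) : 0 ≤ birkhoffMax T f n x := by
  cases n with
  | zero => exact le_rfl
  | succ n => exact le_max_left _ _

theorem birkhoffSum_le_birkhoffMax (n : ℕ) (x : α) :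
    birkhoffSum T f n x ≤ birkhoffMax T f n x := by
  induction n generalizing x with
  | zero => simp [birkhoffMax]
  | succ n ih =>
    rw [birkhoffSum_succ']
    exact le_max_of_le_right (add_le_add_right (ih _) _)

theorem birkhoffMax_le_succ (n : ℕ) (x : α) :
    birkhoffMax T f n x ≤ birkhoffMax T f (n + 1) x := by
  induction n generalizing x with
  | zero => exact le_max_left _ _
  | succ n ih => exact max_le_max le_rfl (add_le_add_right (ih _) _)

/-- The recursion moves a bound from `T x` to `x` and back at the cost of the finite number `f x`.
The set of points with bounded maxima is thus strictly invariant, and ergodicity makes it null or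
conull. -/
theorem bddAbove_range_birkhoffMax_comp (x : α) :
    BddAbove (range fun n => birkhoffMax T f n (T x)) ↔
      BddAbove (range fun n => birkhoffMax T f n x) := by
  constructor
  · rintro ⟨C, hC⟩
    refine ⟨max 0 (f x + C), ?_⟩
    rintro _ ⟨n, rfl⟩
    exact (birkhoffMax_le_succ n x).trans
      (max_le_max le_rfl (add_le_add_right (hC ⟨n, rfl⟩) _))
  · rintro ⟨C, hC⟩
    refine ⟨C - f x, ?_⟩
    rintro _ ⟨n, rfl⟩
    have h1 : birkhoffMax T f (n + 1) x ≤ C := hC ⟨n + 1, rfl⟩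
    have h2 : f x + birkhoffMax T f n (T x) ≤ birkhoffMax T f (n + 1) x := le_max_right _ _
    dsimp only
    linarith

variable [MeasurableSpace α] {μ : Measure α}

theorem measurable_birkhoffMax (hT : Measurable T) (hf : Measurable f) (n : ℕ) :
    Measurable (birkhoffMax T f n) := by
  induction n with
  | zero => exact measurable_const
  | succ n ih => exact measurable_const.max (hf.add (ih.comp hT))

theorem integrable_birkhoffMax (hT : MeasurePreserving T μ μ) (hf : Integrable f μ) (n : ℕ) :
    Integrable (birkhoffMax T f n) μ := by
  induction n with
  | zero => exact integrable_zero _ _ _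
  | succ n ih =>
    exact (integrable_zero _ _ _).sup (hf.add (hT.integrable_comp_of_integrable ih))

/-- Write `M_n` for the maxima. If they were unbounded almost everywhere, `M_{n+1} - M_n ∘ T` would
converge to `f`, dominated by `|f|`. Its integral is nonnegative, since `T` preserves the measure
and `M_n ≤ M_{n+1}`, so `∫ f` would be nonnegative. -/
theorem ae_bddAbove_birkhoffMax (hT : Ergodic T μ) (hfm : Measurable f)
    (hf : Integrable f μ) (hneg : ∫ x, f x ∂μ < 0) :
    ∀ᵐ x ∂μ, BddAbove (range fun n => birkhoffMax T f n x) := by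
  have hmeas : MeasurableSet {x | BddAbove (range fun n => birkhoffMax T f n x)} :=
    measurableSet_bddAbove_range fun n => measurable_birkhoffMax hT.measurable hfm n
  have hinv : T ⁻¹' {x | BddAbove (range fun n => birkhoffMax T f n x)} =
      {x | BddAbove (range fun n => birkhoffMax T f n x)} :=
    Set.ext fun x => bddAbove_range_birkhoffMax_comp x
  rcases hT.toPreErgodic.ae_mem_or_ae_notMem hmeas hinv with h | hunb
  · exact h
  · exfalso
    have hlim : Tendsto (fun n => ∫ x, (birkhoffMax T f (n + 1) x - birkhoffMax T f n (T x)) ∂μ)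
        atTop (𝓝 (∫ x, f x ∂μ)) := by
      refine tendsto_integral_of_dominated_convergence (fun x => |f x|) (fun n => ?_) hf.abs
        (fun n => ?_) ?_
      · exact ((measurable_birkhoffMax hT.measurable hfm (n + 1)).sub
          ((measurable_birkhoffMax hT.measurable hfm n).comp hT.measurable)).aestronglyMeasurable
      · refine Eventually.of_forall fun x => ?_
        have h0 : 0 ≤ birkhoffMax T f n (T x) := birkhoffMax_nonneg _ _
        have h1 : f x + birkhoffMax T f n (T x) ≤ birkhoffMax T f (n + 1) x := le_max_right _ _
        have h2 : birkhoffMax T f (n + 1) x ≤ |f x| + birkhoffMax T f n (T x) :=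
          max_le (by positivity) (add_le_add_left (le_abs_self _) _)
        rw [Real.norm_eq_abs, abs_le]
        constructor
        · linarith [neg_abs_le (f x)]
        · linarith
      · filter_upwards [hunb] with x hx
        rw [← bddAbove_range_birkhoffMax_comp] at hx
        have hmono : Monotone fun n => birkhoffMax T f n (T x) :=
          monotone_nat_of_le_succ fun n => birkhoffMax_le_succ n _
        -- Once `M_n(T x) ≥ -f x`, the maximum with `0` is inactive and the difference equals `f x`
        -- exactly.
        have htop := tendsto_atTop_atTop_of_monotone' hmono hx
        refine tendsto_const_nhds.congr' ?_
        filter_upwards [htop.eventually_ge_atTop (-f x)] with n hn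
        have : birkhoffMax T f (n + 1) x = f x + birkhoffMax T f n (T x) :=
          max_eq_right (by linarith)
        rw [this]; ring
    refine hneg.not_ge (ge_of_tendsto' hlim fun n => ?_)
    have hi1 := integrable_birkhoffMax hT.toMeasurePreserving hf (n + 1)
    have hi := integrable_birkhoffMax hT.toMeasurePreserving hf n
    have hi2 : Integrable (fun x => birkhoffMax T f n (T x)) μ :=
      hT.toMeasurePreserving.integrable_comp_of_integrable hi
    have he : ∫ x, birkhoffMax T f n (T x) ∂μ = ∫ x, birkhoffMax T f n x ∂μ := by
      conv_rhs => rw [← hT.toMeasurePreserving.map_eq]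
      rw [integral_map hT.measurable.aemeasurable
        (measurable_birkhoffMax hT.measurable hfm n).aestronglyMeasurable]
    rw [integral_sub hi1 hi2, he, sub_nonneg]
    exact integral_mono hi hi1 fun x => birkhoffMax_le_succ n x

/-- For `e` strictly between `∫ f` and `c`, the Birkhoff sums of `f - e` are bounded above, and the
gap `n (c - e)` eventually absorbs the bound. -/
theorem ae_eventually_birkhoffSum_le (hT : Ergodic T μ) [IsProbabilityMeasure μ]
    (hfm : Measurable f) (hf : Integrable f μ) {c : ℝ} (hc : ∫ x, f x ∂μ < c) :
    ∀ᵐ x ∂μ, ∀ᶠ n : ℕ in atTop, birkhoffSum T f n x / n ≤ c := by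
  obtain ⟨e, he, hec⟩ := exists_between hc
  have hneg : ∫ x, (f x - e) ∂μ < 0 := by
    rw [integral_sub hf (integrable_const _)]
    simpa using he
  filter_upwards [ae_bddAbove_birkhoffMax hT (hfm.sub_const e) (hf.sub (integrable_const e)) hneg]
    with x ⟨C, hC⟩
  have hS : ∀ n : ℕ, birkhoffSum T f n x - n * e ≤ C := fun n => by
    have h1 := (birkhoffSum_le_birkhoffMax (T := T) (f := fun x => f x - e) n x).trans
      (hC ⟨n, rfl⟩)
    have h2 : birkhoffSum T (fun x => f x - e) n x = birkhoffSum T f n x - n * e := by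
      simp [birkhoffSum, Finset.sum_sub_distrib]
    rwa [h2] at h1
  have hlim : Tendsto (fun n : ℕ => (n : ℝ) * (c - e)) atTop atTop :=
    tendsto_natCast_atTop_atTop.atTop_mul_const (sub_pos.2 hec)
  filter_upwards [hlim.eventually_ge_atTop C, eventually_gt_atTop 0] with n hn hn0
  rw [div_le_iff₀ (by exact_mod_cast hn0)]
  have := hS n
  linarith

/-- **Birkhoff's ergodic theorem** for an ergodic map of a probability space. -/
theorem ae_tendsto_birkhoffSum_div (hT : Ergodic T μ) [IsProbabilityMeasure μ]
    (hfm : Measurable f) (hf : Integrable f μ) :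
    ∀ᵐ x ∂μ, Tendsto (fun n : ℕ => birkhoffSum T f n x / n) atTop (𝓝 (∫ x, f x ∂μ)) := by
  have hup : ∀ m : ℕ, ∀ᵐ x ∂μ, ∀ᶠ n : ℕ in atTop,
      birkhoffSum T f n x / n ≤ ∫ x, f x ∂μ + 1 / ((m : ℝ) + 1) := fun m =>
    ae_eventually_birkhoffSum_le hT hfm hf (by linarith [Nat.one_div_pos_of_nat (α := ℝ) (n := m)])
  have hlo : ∀ m : ℕ, ∀ᵐ x ∂μ, ∀ᶠ n : ℕ in atTop,
      birkhoffSum T (fun x => -f x) n x / n ≤ ∫ x, -f x ∂μ + 1 / ((m : ℝ) + 1) := fun m =>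
    ae_eventually_birkhoffSum_le (f := fun x => -f x) hT hfm.neg hf.neg
      (by linarith [Nat.one_div_pos_of_nat (α := ℝ) (n := m)])
  filter_upwards [ae_all_iff.2 hup, ae_all_iff.2 hlo] with x h1 h2
  refine Metric.tendsto_nhds.2 fun ε hε => ?_
  obtain ⟨m, hm⟩ := exists_nat_one_div_lt hε
  filter_upwards [h1 m, h2 m] with n hn1 hn2
  have h3 : birkhoffSum T (fun x => -f x) n x / n = -(birkhoffSum T f n x / n) := by
    simp [birkhoffSum, Finset.sum_neg_distrib, neg_div]
  rw [h3, integral_neg] at hn2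
  rw [Real.dist_eq, abs_lt]
  constructor <;> linarith

/-- **Maker's ergodic theorem**: an ergodic average along a dominated convergent sequence. -/
theorem ae_tendsto_sum_antidiagonal_div (hT : Ergodic T μ) [IsProbabilityMeasure μ]
    {g : ℕ → α → ℝ} {g' G : α → ℝ} (hg : ∀ n, Measurable (g n)) (hg' : Measurable g')
    (hGm : Measurable G) (hG : Integrable G μ) (hgG : ∀ᵐ x ∂μ, ∀ n, |g n x| ≤ G x)
    (hlim : ∀ᵐ x ∂μ, Tendsto (fun n => g n x) atTop (𝓝 (g' x))) :
    ∀ᵐ x ∂μ, Tendsto (fun n : ℕ => (∑ k ∈ Finset.range n, g (n - k) (T^[k] x)) / n) atTop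
      (𝓝 (∫ x, g' x ∂μ)) := by
  have hg'G : ∀ᵐ x ∂μ, |g' x| ≤ G x := by
    filter_upwards [hgG, hlim] with x h1 h2
    exact le_of_tendsto' h2.abs h1
  have hg'i : Integrable g' μ := hG.mono' hg'.aestronglyMeasurable hg'G
  -- The worst error from index `N` on. It is dominated by `2 G` and tends to `0`, so its integral
  -- can be made small.
  set D : ℕ → α → ℝ := fun N x => ⨆ m, |g (N + m) x - g' x| with hD
  have hDm : ∀ N, Measurable (D N) := fun N =>
    Measurable.iSup fun m => continuous_abs.measurable.comp ((hg (N + m)).sub hg')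
  have hterm : ∀ᵐ x ∂μ, ∀ n, |g n x - g' x| ≤ 2 * G x := by
    filter_upwards [hgG, hg'G] with x h1 h2 n
    have := abs_sub (g n x) (g' x)
    linarith [h1 n]
  have hD0 : ∀ N x, 0 ≤ D N x := fun N x => Real.iSup_nonneg fun m => abs_nonneg _
  have hDG : ∀ N, ∀ᵐ x ∂μ, ‖D N x‖ ≤ 2 * G x := fun N => by
    filter_upwards [hterm] with x h1
    rw [Real.norm_of_nonneg (hD0 N x)]
    exact ciSup_le fun m => h1 _
  have hDi : ∀ N, Integrable (D N) μ := fun N =>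
    (hG.const_mul 2).mono' (hDm N).aestronglyMeasurable (hDG N)
  have hDlim : Tendsto (fun N => ∫ x, D N x ∂μ) atTop (𝓝 0) := by
    have h0 : ∫ _x : α, (0 : ℝ) ∂μ = 0 := by simp
    rw [← h0]
    refine tendsto_integral_of_dominated_convergence (fun x => 2 * G x)
      (fun N => (hDm N).aestronglyMeasurable) (hG.const_mul 2) hDG ?_
    filter_upwards [hlim] with x hx
    refine Metric.tendsto_atTop.2 fun ε hε => ?_
    obtain ⟨N₀, hN₀⟩ := Metric.tendsto_atTop.1 hx (ε / 2) (by positivity)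
    refine ⟨N₀, fun N hN => ?_⟩
    have : D N x ≤ ε / 2 := ciSup_le fun m => (hN₀ (N + m) (by omega)).le
    rw [Real.dist_eq, sub_zero, abs_of_nonneg (hD0 N x)]
    linarith
  have hBD := ae_all_iff.2 fun N => ae_tendsto_birkhoffSum_div hT (hDm N) (hDi N)
  have hBG := ae_tendsto_birkhoffSum_div hT (hGm.const_mul 2) (hG.const_mul 2)
  have hBg := ae_tendsto_birkhoffSum_div hT hg' hg'i
  have horb : ∀ᵐ x ∂μ, ∀ k n, |g n (T^[k] x) - g' (T^[k] x)| ≤ 2 * G (T^[k] x) :=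
    ae_all_iff.2 fun k =>
      (hT.toMeasurePreserving.iterate k).quasiMeasurePreserving.ae hterm
  filter_upwards [hBD, hBG, hBg, horb] with x h1 h2 h3 h4
  -- For `k < n` the index `n + N - k` is at least `N`, so the error is at most `D N`. The last `N`
  -- terms are bounded by `2 G`.
  have hkey : ∀ N n : ℕ, |∑ k ∈ Finset.range (n + N), g (n + N - k) (T^[k] x)
      - birkhoffSum T g' (n + N) x| ≤ birkhoffSum T (D N) (n + N) x
        + (birkhoffSum T (fun x => 2 * G x) (n + N) x - birkhoffSum T (fun x => 2 * G x) n x) := by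
    intro N n
    have hG0 : ∀ k, 0 ≤ 2 * G (T^[k] x) := fun k => (abs_nonneg _).trans (h4 k 0)
    simp only [birkhoffSum, ← Finset.sum_sub_distrib]
    refine (Finset.abs_sum_le_sum_abs _ _).trans ?_
    rw [Finset.sum_range_add (fun k => 2 * G (T^[k] x)), add_sub_cancel_left, Finset.sum_range_add,
      Finset.sum_range_add (fun k => D N (T^[k] x)), add_assoc, ← Finset.sum_add_distrib]
    refine add_le_add (Finset.sum_le_sum fun k hk => ?_) (Finset.sum_le_sum fun k hk => ?_)
    · obtain ⟨m, hm⟩ := Nat.exists_eq_add_of_le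
        (show N ≤ n + N - k by have := Finset.mem_range.1 hk; omega)
      rw [hm]
      exact le_ciSup (f := fun m => |g (N + m) (T^[k] x) - g' (T^[k] x)|)
        ⟨2 * G (T^[k] x), by rintro _ ⟨m, rfl⟩; exact h4 k _⟩ m
    · exact (h4 _ _).trans (le_add_of_nonneg_left (hD0 _ _))
  have hdiff : Tendsto (fun n : ℕ => (∑ k ∈ Finset.range n, g (n - k) (T^[k] x)
      - birkhoffSum T g' n x) / n) atTop (𝓝 0) := by
    refine Metric.tendsto_nhds.2 fun ε hε => ?_
    obtain ⟨N, hN⟩ := (hDlim.eventually_lt_const hε).exists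
    -- The last `N` terms of the Birkhoff sum of `2 G` are negligible: they are a difference of two
    -- averages with the same limit, after rescaling by `n / (n + N) → 1`.
    have hR : Tendsto (fun n : ℕ => birkhoffSum T (D N) (n + N) x / (n + N : ℕ)
        + (birkhoffSum T (fun x => 2 * G x) (n + N) x / (n + N : ℕ)
          - birkhoffSum T (fun x => 2 * G x) n x / n * (n / (n + N)))) atTop
        (𝓝 (∫ x, D N x ∂μ + (∫ x, 2 * G x ∂μ - (∫ x, 2 * G x ∂μ) * 1))) :=
      ((h1 N).comp (tendsto_add_atTop_nat N)).add
        ((h2.comp (tendsto_add_atTop_nat N)).sub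
          (h2.mul (tendsto_natCast_div_add_atTop (N : ℝ))))
    rw [mul_one, sub_self, add_zero] at hR
    have hev := hR.eventually_lt_const hN
    rw [← map_add_atTop_eq_nat N, eventually_map]
    filter_upwards [hev, eventually_gt_atTop 0] with n hn hn0
    have hn0' : (0 : ℝ) < n := by exact_mod_cast hn0
    have hpos : (0 : ℝ) < (n + N : ℕ) := by push_cast; positivity
    rw [Real.dist_eq, sub_zero, abs_div, abs_of_pos hpos]
    refine lt_of_le_of_lt ?_ hn
    rw [div_le_iff₀ hpos]
    refine (hkey N n).trans (le_of_eq ?_)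
    push_cast
    field_simp
  have := hdiff.add h3
  rw [zero_add] at this
  refine this.congr fun n => ?_
  rw [← add_div]; ring

end Ergodic

/-! ### Bernoulli shifts -/

section Bernoulli

instance (p : PMF ℕ+) : IsProbabilityMeasure (bernoulliOneSided p) := by
  unfold bernoulliOneSided; infer_instance

instance (p : PMF ℕ+) : IsProbabilityMeasure (bernoulliTwoSided p) := by
  unfold bernoulliTwoSided; infer_instance

theorem measurable_sigma : Measurable sigma :=
  measurable_pi_lambda _ fun k => measurable_pi_apply (k + 1)

theorem measurePreserving_sigma (p : PMF ℕ+) :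
    MeasurePreserving sigma (bernoulliOneSided p) (bernoulliOneSided p) :=
  ⟨measurable_sigma, Measure.map_infinitePi_infinitePi_of_inj (P := fun _ : ℕ => p.toMeasure)
    (f := fun k : ℕ => k + 1) (add_left_injective 1)⟩

/-- The coordinates of nonnegative index of a two-sided sequence. -/
def future (l : Param) : Code := fun k => l k

theorem measurePreserving_future (p : PMF ℕ+) :
    MeasurePreserving future (bernoulliTwoSided p) (bernoulliOneSided p) :=
  ⟨measurable_pi_lambda _ fun k => measurable_pi_apply (k : ℤ),
    Measure.map_infinitePi_infinitePi_of_inj (P := fun _ : ℤ => p.toMeasure)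
    (f := fun k : ℕ => (k : ℤ)) Nat.cast_injective⟩

theorem map_eval_bernoulliOneSided (p : PMF ℕ+) (k : ℕ) :
    (bernoulliOneSided p).map (fun w => w k) = p.toMeasure :=
  Measure.infinitePi_map_eval (fun _ : ℕ => p.toMeasure) k

theorem iterate_sigma_apply (n : ℕ) (w : Code) (k : ℕ) : sigma^[n] w k = w (k + n) := by
  induction n generalizing w with
  | zero => rfl
  | succ n ih =>
    rw [Function.iterate_succ_apply, ih]
    change w (k + n + 1) = _
    rw [add_assoc]

/-- The one-sided skew product `(λ, ω) ↦ (θ λ, σ ω)`. -/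
def skew (z : Code × Code) : Code × Code := (sigma z.1, sigma z.2)

theorem iterate_skew (n : ℕ) (z : Code × Code) :
    skew^[n] z = (sigma^[n] z.1, sigma^[n] z.2) := by
  induction n generalizing z with
  | zero => rfl
  | succ n ih => rw [Function.iterate_succ_apply, ih]; rfl

/-- The coordinates on `Code × Code`. -/
def coord : ℕ ⊕ ℕ → Code × Code → ℕ+
  | .inl k, z => z.1 k
  | .inr k, z => z.2 k

theorem measurable_coord (i : ℕ ⊕ ℕ) : Measurable (coord i) := by
  cases i with
  | inl k => exact (measurable_pi_apply k).comp measurable_fst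
  | inr k => exact (measurable_pi_apply k).comp measurable_snd

theorem iIndepFun_coord (p q : PMF ℕ+) :
    iIndepFun coord ((bernoulliOneSided p).prod (bernoulliOneSided q)) := by
  rw [iIndepFun_iff_map_fun_eq_infinitePi_map measurable_coord]
  have hl : ∀ k, ((bernoulliOneSided p).prod (bernoulliOneSided q)).map (coord (.inl k))
      = p.toMeasure := fun k => by
    rw [show coord (.inl k) = (fun w : Code => w k) ∘ Prod.fst from rfl,
      ← Measure.map_map (measurable_pi_apply k) measurable_fst, Measure.map_fst_prod,
      measure_univ, one_smul, map_eval_bernoulliOneSided]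
  have hr : ∀ k, ((bernoulliOneSided p).prod (bernoulliOneSided q)).map (coord (.inr k))
      = q.toMeasure := fun k => by
    rw [show coord (.inr k) = (fun w : Code => w k) ∘ Prod.snd from rfl,
      ← Measure.map_map (measurable_pi_apply k) measurable_snd, Measure.map_snd_prod,
      measure_univ, one_smul, map_eval_bernoulliOneSided]
  have : ∀ i, IsProbabilityMeasure
      (((bernoulliOneSided p).prod (bernoulliOneSided q)).map (coord i)) := fun i =>
    Measure.isProbabilityMeasure_map (measurable_coord i).aemeasurable
  refine Measure.eq_infinitePi _ fun s t ht => ?_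
  have hpre : (fun z i => coord i z) ⁻¹' (Set.pi s t) =
      (Set.pi (s.toLeft : Set ℕ) fun k => t (.inl k)) ×ˢ
        (Set.pi (s.toRight : Set ℕ) fun k => t (.inr k)) := by
    ext z
    simp only [mem_preimage, Set.mem_pi, mem_prod, Finset.mem_coe, Finset.mem_toLeft,
      Finset.mem_toRight, Sum.forall]
    rfl
  rw [Measure.map_apply (measurable_pi_lambda _ measurable_coord)
      (MeasurableSet.pi s.countable_toSet fun i _ => ht i), hpre, Measure.prod_prod]
  unfold bernoulliOneSided at *
  rw [Measure.infinitePi_pi _ fun k _ => ht _, Measure.infinitePi_pi _ fun k _ => ht _]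
  conv_rhs => rw [← Finset.toLeft_disjSum_toRight (u := s), Finset.prod_disjSum]
  simp only [hl, hr]

theorem measurePreserving_skew (p q : PMF ℕ+) :
    MeasurePreserving skew ((bernoulliOneSided p).prod (bernoulliOneSided q))
      ((bernoulliOneSided p).prod (bernoulliOneSided q)) :=
  (measurePreserving_sigma p).prod (measurePreserving_sigma q)

/-- An invariant set is a tail event for the independent family of all letters of both sequences, so
Kolmogorov's zero-one law applies. -/
theorem ergodic_skew (p q : PMF ℕ+) :
    Ergodic skew ((bernoulliOneSided p).prod (bernoulliOneSided q)) := by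
  refine ⟨measurePreserving_skew p q, ⟨fun A hA hinv => ?_⟩⟩
  set s : ℕ ⊕ ℕ → MeasurableSpace (Code × Code) := fun i =>
    MeasurableSpace.comap (coord i) inferInstance with hs
  have htail : MeasurableSet[limsup s cofinite] A := by
    rw [limsup_eq_iInf_iSup, MeasurableSpace.measurableSet_iInf]
    intro t
    rw [MeasurableSpace.measurableSet_iInf]
    intro ht
    obtain ⟨n, hn⟩ : ∃ n, ∀ k, n ≤ k → Sum.inl k ∈ t ∧ Sum.inr k ∈ t := by
      have h1 := Sum.inl_injective.tendsto_cofinite (α := ℕ) (β := ℕ ⊕ ℕ) |>.eventually ht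
      have h2 := Sum.inr_injective.tendsto_cofinite (α := ℕ) (β := ℕ ⊕ ℕ) |>.eventually ht
      rw [Nat.cofinite_eq_atTop] at h1 h2
      exact eventually_atTop.1 (h1.and h2)
    -- By invariance `A` is the preimage of itself under `skew^[n]`, which reads only letters of
    -- index at least `n` in either sequence.
    have hAn : skew^[n] ⁻¹' A = A := by
      rw [preimage_iterate_eq]
      exact Function.iterate_fixed hinv n
    have hcoord : ∀ i ∈ t, Measurable[⨆ i ∈ t, s i] (coord i) := fun i hi =>
      (comap_measurable (coord i)).mono (le_iSup₂ (f := fun i _ => s i) i hi) le_rfl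
    have hmeas : Measurable[⨆ i ∈ t, s i] (skew^[n]) := by
      rw [funext (iterate_skew n)]
      refine @Measurable.prodMk _ (⨆ i ∈ t, s i) _ _ _ _ _ _ ?_ ?_
      · refine @measurable_pi_lambda _ _ _ (⨆ i ∈ t, s i) _ _ fun k => ?_
        simp only [iterate_sigma_apply]
        exact hcoord (.inl (k + n)) (hn _ (by omega)).1
      · refine @measurable_pi_lambda _ _ _ (⨆ i ∈ t, s i) _ _ fun k => ?_
        simp only [iterate_sigma_apply]
        exact hcoord (.inr (k + n)) (hn _ (by omega)).2
    rw [← hAn]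
    exact hmeas hA
  have h01 := measure_zero_or_one_of_measurableSet_limsup (s := s) (f := cofinite)
    (p := fun t : Set (ℕ ⊕ ℕ) => t.Finite) (ns := fun t : Finset (ℕ ⊕ ℕ) => (t : Set (ℕ ⊕ ℕ)))
    (fun i => (measurable_coord i).comap_le) (iIndepFun_coord p q)
    (fun t ht => ht.compl_mem_cofinite)
    (fun a b => ⟨a ∪ b, by simp, by simp⟩) (fun t => t.finite_toSet)
    (fun i => ⟨{i}, by simp⟩) htail
  rw [eventuallyConst_set]
  rcases h01 with h | h
  · exact .inr (measure_eq_zero_iff_ae_notMem.1 h)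
  · exact .inl ((mem_ae_iff_prob_eq_one hA).2 h)

end Bernoulli

/-! ### Hausdorff and packing dimensions of exact dimensional measures -/

section Dimensions

variable {X : Type*} [MetricSpace X] [MeasurableSpace X] {μ : Measure X} {x : X} {d : ℝ}

theorem HasPointwiseDim.eventually_measureReal_ball_le (h : HasPointwiseDim μ x d) {s : ℝ}
    (hs : s < d) : ∀ᶠ r in 𝓝[>] (0 : ℝ), μ.real (Metric.ball x r) ≤ r ^ s := by
  filter_upwards [h.eventually_const_lt hs, Real.tendsto_log_nhdsGT_zero.eventually_lt_atBot 0,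
    self_mem_nhdsWithin] with r hr hlog hr0
  -- Null balls need a separate case because `Real.log 0 = 0`.
  rcases measureReal_nonneg (μ := μ) (s := Metric.ball x r).eq_or_lt with h0 | h0
  · rw [← h0]; exact Real.rpow_nonneg (le_of_lt hr0) _
  · rw [lt_div_iff_of_neg hlog] at hr
    rw [← Real.log_le_log_iff h0 (Real.rpow_pos_of_pos hr0 _), Real.log_rpow hr0]
    exact hr.le

/-- The base `2 * r` matches the weights in the packing premeasure. An exponent `t` between `d` and
`s` leaves room for the factor `2 ^ s`, since `(s - t) log r → -∞`. -/
theorem HasPointwiseDim.eventually_rpow_le_measureReal_ball (h : HasPointwiseDim μ x d)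
    (hpos : ∀ r > 0, 0 < μ.real (Metric.ball x r)) {s : ℝ} (hs : d < s) :
    ∀ᶠ r in 𝓝[>] (0 : ℝ), (2 * r) ^ s ≤ μ.real (Metric.ball x r) := by
  obtain ⟨t, hdt, hts⟩ := exists_between hs
  have h1 : Tendsto (fun r => (s - t) * Real.log r + s * Real.log 2) (𝓝[>] 0) atBot :=
    tendsto_atBot_add_const_right _ _
      (Real.tendsto_log_nhdsGT_zero.const_mul_atBot (sub_pos.2 hts))
  filter_upwards [h.eventually_lt_const hdt, Real.tendsto_log_nhdsGT_zero.eventually_lt_atBot 0,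
    self_mem_nhdsWithin, h1.eventually_le_atBot 0] with r hr hlog hr0 hle
  have hr0' : 0 < r := hr0
  rw [div_lt_iff_of_neg hlog] at hr
  rw [← Real.log_le_log_iff (by positivity) (hpos r hr0), Real.log_rpow (by positivity),
    Real.log_mul two_ne_zero hr0'.ne']
  nlinarith

theorem exists_nat_forall_lt_of_eventually {P : ℝ → Prop} (h : ∀ᶠ r in 𝓝[>] (0 : ℝ), P r) :
    ∃ n : ℕ, ∀ r, 0 < r → r < 1 / ((n : ℝ) + 1) → P r := by
  obtain ⟨ε, hε, hP⟩ := mem_nhdsGT_iff_exists_Ioo_subset.1 h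
  obtain ⟨n, hn⟩ := exists_nat_one_div_lt (show (0 : ℝ) < ε from hε)
  exact ⟨n, fun r h0 h1 => hP ⟨h0, h1.trans hn⟩⟩

variable [BorelSpace X]

/-- The mass distribution principle for the pointwise dimension. -/
theorem le_dimH_of_hasPointwiseDim [IsFiniteMeasure μ] (h : ∀ᵐ x ∂μ, HasPointwiseDim μ x d)
    {Y : Set X} (hY : 0 < μ Y) : ENNReal.ofReal d ≤ dimH Y := by
  refine ENNReal.le_of_forall_nnreal_lt fun s hs => ?_
  have hsd : (s : ℝ) < d := by
    rw [← ENNReal.ofReal_coe_nnreal] at hs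
    exact (ENNReal.ofReal_lt_ofReal_iff_of_nonneg s.coe_nonneg).1 hs
  refine le_dimH_of_hausdorffMeasure_ne_zero ?_
  -- The bound on balls is made uniform in the radius by restricting to `A n`; these sets exhaust
  -- almost all of `Y`, so one of them has positive measure.
  set A : ℕ → Set X := fun n => {x ∈ Y | ∀ r, 0 < r → r < 1 / ((n : ℝ) + 1) →
    μ.real (Metric.ball x r) ≤ r ^ (s : ℝ)} with hA
  obtain ⟨n, hn⟩ : ∃ n, μ (A n) ≠ 0 := by
    by_contra! hcon
    refine hY.ne' (measure_mono_null (t := (⋃ n, A n) ∪ {x | ¬ HasPointwiseDim μ x d}) ?_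
      (measure_union_null (measure_iUnion_null hcon) h))
    intro x hx
    by_cases hd : HasPointwiseDim μ x d
    · obtain ⟨n, hn⟩ := exists_nat_forall_lt_of_eventually
        (hd.eventually_measureReal_ball_le hsd)
      exact .inl (mem_iUnion.2 ⟨n, hx, hn⟩)
    · exact .inr hd
  -- A set of small diameter `D` whose closure meets `A n` at `x` lies in every ball about `x` of
  -- radius `r > D`. Passing to the closure makes the set measurable.
  have hle : μ.restrict (A n) ≤ μH[(s : ℝ)] := by
    set ε : ℝ := 1 / ((n : ℝ) + 1) with hε
    have hε0 : 0 < ε := by positivity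
    refine Measure.le_hausdorffMeasure _ _ (ENNReal.ofReal (ε / 2)) (by simpa using hε0) ?_
    intro t ht
    refine (measure_mono subset_closure).trans ?_
    rw [Measure.restrict_apply isClosed_closure.measurableSet]
    rcases (closure t ∩ A n).eq_empty_or_nonempty with he | ⟨x, hxt, hx⟩
    · simp [he]
    have hfin : Metric.ediam t ≠ ⊤ := ne_top_of_le_ne_top ENNReal.ofReal_ne_top ht
    obtain ⟨D, hD⟩ : ∃ D : ℝ≥0, (D : ℝ≥0∞) = Metric.ediam t := ⟨_, ENNReal.coe_toNNReal hfin⟩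
    have hDε : (D : ℝ) < ε := by
      rw [← hD, ← ENNReal.ofReal_coe_nnreal, ENNReal.ofReal_le_ofReal_iff (by positivity)] at ht
      linarith
    have hball : ∀ r : ℝ, (D : ℝ) < r → r < ε →
        μ (closure t ∩ A n) ≤ ENNReal.ofReal (r ^ (s : ℝ)) := by
      intro r hDr hrε
      have hr0 : 0 < r := D.coe_nonneg.trans_lt hDr
      refine (measure_mono (t := Metric.ball x r) ?_).trans ?_
      · rintro y ⟨hy, -⟩
        have : edist y x ≤ Metric.ediam (closure t) := Metric.edist_le_ediam_of_mem hy hxt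
        rw [Metric.ediam_closure, ← hD, edist_le_coe] at this
        exact lt_of_le_of_lt (show dist y x ≤ D by exact_mod_cast this) hDr
      · rw [← ofReal_measureReal]
        exact ENNReal.ofReal_le_ofReal (hx.2 r hr0 hrε)
    -- Letting `r` decrease to `D` gives the exact bound `D ^ s`, including the case `D = 0`.
    have hlim : Tendsto (fun r : ℝ => ENNReal.ofReal (r ^ (s : ℝ))) (𝓝[>] (D : ℝ))
        (𝓝 (ENNReal.ofReal ((D : ℝ) ^ (s : ℝ)))) :=
      ((ENNReal.continuous_ofReal.comp (Real.continuous_rpow_const s.coe_nonneg)).tendsto _).mono_left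
        nhdsWithin_le_nhds
    have := ge_of_tendsto hlim (b := μ (closure t ∩ A n)) (by
      filter_upwards [Ioo_mem_nhdsGT hDε] with r hr
      exact hball r hr.1 hr.2)
    rwa [← hD, ← ENNReal.ofReal_coe_nnreal, ENNReal.ofReal_rpow_of_nonneg D.coe_nonneg s.coe_nonneg]
  refine (lt_of_lt_of_le (pos_iff_ne_zero.2 hn) ?_).ne'
  refine le_trans ?_ ((hle (A n)).trans (measure_mono fun x hx => hx.1))
  simp

end Dimensions

theorem lowerDim_le_upperDim {X : Type*} [MeasurableSpace X] (dim : Set X → ℝ≥0∞) (μ : Measure X) [NeZero μ] :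
    lowerDim dim μ ≤ upperDim dim μ := by
  refine le_iInf fun Y => le_iInf₂ fun hYm hY => iInf₂_le_of_le Y hYm (iInf_le_of_le ?_ le_rfl)
  rw [pos_iff_ne_zero]
  intro h0
  refine NeZero.ne (μ univ) (le_antisymm ?_ zero_le)
  rw [← union_compl_self Y]
  exact (measure_union_le _ _).trans (by rw [h0, hY, add_zero])

/-! ### Packing dimension: comparison with Hausdorff dimension, and upper bounds -/

section Packing

variable {X : Type*} [MetricSpace X]

/-- A packing of maximal cardinality works: a point of `A` farther than `2 η` from all centres could
be added to it. -/
theorem exists_finset_cover_of_packing_bounded {A : Set X} {η : ℝ} (hη : 0 < η) {N : ℕ}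
    (hN : ∀ t : Finset X, IsPacking A η t (fun _ => η) → t.card ≤ N) :
    ∃ t : Finset X, IsPacking A η t (fun _ => η) ∧
      A ⊆ ⋃ x : t, Metric.closedBall (x : X) (2 * η) := by
  classical
  set S : Set ℕ := {k | ∃ t : Finset X, IsPacking A η t (fun _ => η) ∧ t.card = k} with hS
  have hne : S.Nonempty := ⟨0, ∅, ⟨by simp, by simp, by simp⟩, rfl⟩
  have hbdd : BddAbove S := ⟨N, by rintro _ ⟨t, ht, rfl⟩; exact hN t ht⟩
  obtain ⟨t, ht, hcard⟩ := Nat.sSup_mem hne hbdd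
  refine ⟨t, ht, fun y hy => ?_⟩
  by_contra hcon
  simp only [mem_iUnion, Metric.mem_closedBall, Subtype.exists, not_exists, not_le] at hcon
  have hyt : y ∉ t := fun hyt => by
    have := hcon y hyt
    rw [dist_self] at this
    linarith
  have hpack : IsPacking A η (insert y t) (fun _ => η) := by
    refine ⟨?_, fun _ _ => ⟨hη, le_rfl⟩, ?_⟩
    · rw [Finset.coe_insert]; exact insert_subset hy ht.1
    · rw [Finset.coe_insert]
      refine ht.2.2.insert fun x hx _ => ?_
      refine Set.disjoint_left.2 fun z hz1 hz2 => ?_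
      have := dist_triangle_left y x z
      have h1 := hcon x hx
      have h2 : dist z y ≤ η := hz1
      have h3 : dist z x ≤ η := hz2
      linarith
  have := le_csSup hbdd (show (insert y t).card ∈ S from ⟨_, hpack, rfl⟩)
  rw [Finset.card_insert_of_notMem hyt, ← hcard] at this
  omega

variable [MeasurableSpace X] [BorelSpace X]

/-- Doubling the balls of a maximal packing of constant radius `η` covers `A` by sets of diameter at
most `4 η = 2 (2 η)`, which accounts for the factor `2 ^ s`. -/
theorem hausdorffMeasure_le_packingPremeasure (s : ℝ≥0) (A : Set X) :
    μH[(s : ℝ)] A ≤ 2 ^ (s : ℝ) * packingPremeasure s A := by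
  refine ENNReal.le_mul_of_forall_lt (.inl (by simp))
    (.inl (ENNReal.rpow_ne_top_of_nonneg s.coe_nonneg ENNReal.ofNat_ne_top)) fun c hc C hC => ?_
  obtain ⟨B, hC, hBC⟩ := exists_between (show packingPremeasure s A < C from hC)
  refine le_trans ?_ (mul_le_mul_right hBC.le c)
  simp only [packingPremeasure, iInf_lt_iff] at hC
  obtain ⟨δ, hδ, hlt⟩ := hC
  have hsum : ∀ η, 0 < η → η ≤ δ → ∀ t : Finset X, IsPacking A η t (fun _ => η) →
      t.card * ENNReal.ofReal (2 * η) ^ (s : ℝ) ≤ B := by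
    intro η hη hηδ t ht
    have hp : IsPacking A δ t (fun _ => η) := ⟨ht.1, fun _ _ => ⟨hη, hηδ⟩, ht.2.2⟩
    refine le_trans (le_of_eq ?_) ((le_iSup₂_of_le t (fun _ => η) (le_iSup_of_le hp le_rfl)).trans
      hlt.le)
    simp
  have hcov : ∀ n : ℕ, ∃ t : Finset X, 1 / ((n : ℝ) + 1) ≤ δ →
      IsPacking A (1 / ((n : ℝ) + 1)) t (fun _ => 1 / ((n : ℝ) + 1)) ∧
      A ⊆ ⋃ x : t, Metric.closedBall (x : X) (2 * (1 / ((n : ℝ) + 1))) := by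
    intro n
    by_cases hn : 1 / ((n : ℝ) + 1) ≤ δ
    · have hη : 0 < 1 / ((n : ℝ) + 1) := by positivity
      have hpos : ENNReal.ofReal (2 * (1 / ((n : ℝ) + 1))) ^ (s : ℝ) ≠ 0 :=
        (ENNReal.rpow_pos (by simpa using by positivity) ENNReal.ofReal_ne_top).ne'
      -- Every ball of a packing of radius `η` has the same positive weight, so the bound `B` on the
      -- total weight limits the number of balls, and a maximal packing exists.
      obtain ⟨N, hN⟩ := ENNReal.exists_nat_gt (ENNReal.div_lt_top hBC.ne_top hpos).ne
      obtain ⟨t, ht⟩ := exists_finset_cover_of_packing_bounded hη (A := A) (N := N) fun t ht => by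
        have h1 := hsum _ hη hn t ht
        have h2 : (t.card : ℝ≥0∞) ≤ B / ENNReal.ofReal (2 * (1 / ((n : ℝ) + 1))) ^ (s : ℝ) := by
          rw [ENNReal.le_div_iff_mul_le (.inl hpos)
            (.inl (ENNReal.rpow_ne_top_of_nonneg s.coe_nonneg ENNReal.ofReal_ne_top))]
          exact h1
        exact_mod_cast (h2.trans_lt hN).le
      exact ⟨t, fun _ => ht⟩
    · exact ⟨∅, fun h => absurd h hn⟩
  choose t ht using hcov
  have hev : ∀ᶠ n : ℕ in atTop, 1 / ((n : ℝ) + 1) ≤ δ :=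
    tendsto_one_div_add_atTop_nhds_zero_nat.eventually_le_const hδ
  have hdiam : ∀ (n : ℕ) (x : X), Metric.ediam (Metric.closedBall x (2 * (1 / ((n : ℝ) + 1))))
      ≤ 2 * ENNReal.ofReal (2 * (1 / ((n : ℝ) + 1))) := fun n x => by
    rw [← Metric.closedEBall_ofReal (by positivity)]
    exact Metric.ediam_closedEBall_le
  refine (Measure.hausdorffMeasure_le_liminf_sum (s : ℝ) A (l := atTop)
    (fun n : ℕ => 2 * ENNReal.ofReal (2 * (1 / ((n : ℝ) + 1)))) ?_
    (fun (n : ℕ) (x : t n) => Metric.closedBall (x : X) (2 * (1 / ((n : ℝ) + 1))))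
    (Eventually.of_forall fun n x => hdiam n x) (hev.mono fun n hn => (ht n hn).2)).trans ?_
  · have h1 : Tendsto (fun n : ℕ => 2 * (1 / ((n : ℝ) + 1))) atTop (𝓝 0) := by
      simpa using tendsto_one_div_add_atTop_nhds_zero_nat.const_mul (2 : ℝ)
    have h2 := ENNReal.Tendsto.const_mul (a := 2) (ENNReal.tendsto_ofReal h1)
      (.inr ENNReal.ofNat_ne_top)
    simpa using h2
  · refine liminf_le_of_frequently_le' (Eventually.frequently ?_)
    filter_upwards [hev] with n hn
    have h1 := hsum _ (by positivity) hn (t n) (ht n hn).1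
    calc ∑ x : t n, Metric.ediam (Metric.closedBall (x : X) (2 * (1 / ((n : ℝ) + 1)))) ^ (s : ℝ)
        ≤ ∑ x : t n, 2 ^ (s : ℝ) * ENNReal.ofReal (2 * (1 / ((n : ℝ) + 1))) ^ (s : ℝ) := by
          refine Finset.sum_le_sum fun x _ => ?_
          rw [← ENNReal.mul_rpow_of_nonneg _ _ s.coe_nonneg]
          exact ENNReal.rpow_le_rpow (hdiam n x) s.coe_nonneg
      _ = 2 ^ (s : ℝ) * ((t n).card * ENNReal.ofReal (2 * (1 / ((n : ℝ) + 1))) ^ (s : ℝ)) := by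
          simp only [Finset.sum_const, Finset.card_univ, Fintype.card_coe, nsmul_eq_mul]
          ring
      _ ≤ c * B := mul_le_mul' hc.le h1

theorem dimH_le_dimP (A : Set X) : dimH A ≤ dimP A := by
  refine le_iInf₂ fun s hs => dimH_le_of_hausdorffMeasure_ne_top ?_
  have h2 : (2 : ℝ≥0∞) ^ (s : ℝ) ≠ ⊤ := ENNReal.rpow_ne_top_of_nonneg s.coe_nonneg ENNReal.ofNat_ne_top
  have hle : μH[(s : ℝ)] A ≤ 2 ^ (s : ℝ) * packingMeasure s A := by
    unfold packingMeasure
    rw [ENNReal.mul_iInf_of_ne (by simp) h2]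
    refine le_iInf fun c => ?_
    rw [ENNReal.mul_iInf' (fun h => absurd h h2) (fun h => absurd h (by simp))]
    refine le_iInf fun hc => ?_
    rw [← ENNReal.tsum_mul_left]
    exact (measure_mono hc).trans ((measure_iUnion_le _).trans
      (ENNReal.tsum_le_tsum fun i => hausdorffMeasure_le_packingPremeasure s (c i)))
  rw [hs, mul_zero] at hle
  exact ne_top_of_le_ne_top ENNReal.zero_ne_top hle

/-- Splitting `(2 r) ^ u = (2 r) ^ (u - s) (2 r) ^ s` bounds each term by `(2 δ) ^ (u - s)` times
the mass of its ball. The balls are disjoint, so the sum is at most `(2 δ) ^ (u - s)` times the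
total mass, which vanishes as `δ → 0`. -/
theorem packingPremeasure_eq_zero {μ : Measure X} [IsFiniteMeasure μ] {A : Set X} {ε s : ℝ}
    (hε : 0 < ε) {u : ℝ≥0} (hsu : s < u)
    (hA : ∀ x ∈ A, ∀ r, 0 < r → r < ε → (2 * r) ^ s ≤ μ.real (Metric.ball x r)) :
    packingPremeasure u A = 0 := by
  have hbound : ∀ δ, 0 < δ → δ < ε → packingPremeasure u A ≤
      ENNReal.ofReal ((2 * δ) ^ (u - s)) * μ univ := by
    intro δ hδ hδε
    refine iInf₂_le_of_le δ hδ (iSup₂_le fun t r => iSup_le fun hp => ?_)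
    have hterm : ∀ x ∈ t, ENNReal.ofReal (2 * r x) ^ (u : ℝ) ≤
        ENNReal.ofReal ((2 * δ) ^ (u - s)) * μ (Metric.closedBall x (r x)) := by
      intro x hx
      obtain ⟨hr0, hrδ⟩ := hp.2.1 x hx
      have h1 : (2 * r x) ^ (u : ℝ) ≤ (2 * δ) ^ (u - s) * μ.real (Metric.closedBall x (r x)) := by
        rw [show (u : ℝ) = (u - s) + s by ring, Real.rpow_add (by positivity)]
        have h2 : (2 * r x) ^ s ≤ μ.real (Metric.closedBall x (r x)) :=
          (hA x (hp.1 hx) _ hr0 (hrδ.trans_lt hδε)).trans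
            (measureReal_mono Metric.ball_subset_closedBall)
        rw [show u - s + s - s = u - s by ring]
        gcongr
      rw [ENNReal.ofReal_rpow_of_nonneg (by positivity) u.coe_nonneg, ← ofReal_measureReal,
        ← ENNReal.ofReal_mul (by positivity)]
      exact ENNReal.ofReal_le_ofReal h1
    calc ∑ x ∈ t, ENNReal.ofReal (2 * r x) ^ (u : ℝ)
        ≤ ∑ x ∈ t, ENNReal.ofReal ((2 * δ) ^ (u - s)) * μ (Metric.closedBall x (r x)) :=
          Finset.sum_le_sum hterm
      _ = ENNReal.ofReal ((2 * δ) ^ (u - s)) * μ (⋃ x ∈ t, Metric.closedBall x (r x)) := by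
          rw [← Finset.mul_sum, measure_biUnion_finset hp.2.2
            fun x _ => Metric.isClosed_closedBall.measurableSet]
      _ ≤ _ := mul_le_mul_right (measure_mono (subset_univ _)) _
  have hlim : Tendsto (fun δ : ℝ => ENNReal.ofReal ((2 * δ) ^ (u - s)) * μ univ) (𝓝[>] 0)
      (𝓝 0) := by
    have h1 : Tendsto (fun δ : ℝ => (2 * δ) ^ (u - s)) (𝓝 0) (𝓝 ((2 * 0) ^ (u - s))) :=
      ((Real.continuous_rpow_const (sub_pos.2 hsu).le).comp (continuous_const_mul 2)).tendsto 0
    rw [mul_zero, Real.zero_rpow (sub_pos.2 hsu).ne'] at h1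
    have h2 := ENNReal.Tendsto.mul_const (b := μ univ) (ENNReal.tendsto_ofReal h1)
      (.inr (measure_ne_top _ _))
    rw [ENNReal.ofReal_zero, zero_mul] at h2
    exact h2.mono_left nhdsWithin_le_nhds
  refine le_antisymm (ge_of_tendsto hlim ?_) zero_le
  filter_upwards [Ioo_mem_nhdsGT hε] with δ hδ
  exact hbound δ hδ.1 hδ.2

theorem dimP_le_of_hasPointwiseDim {μ : Measure X} [IsFiniteMeasure μ] {d : ℝ} (hd : 0 ≤ d)
    {Y : Set X} (hY : ∀ x ∈ Y, HasPointwiseDim μ x d)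
    (hpos : ∀ x ∈ Y, ∀ r > 0, 0 < μ.real (Metric.ball x r)) : dimP Y ≤ ENNReal.ofReal d := by
  refine ENNReal.le_of_forall_pos_le_add fun ε hε _ => ?_
  have hu : ENNReal.ofReal d + ε = (d.toNNReal + ε : ℝ≥0) := by
    rw [ENNReal.coe_add]; rfl
  rw [hu]
  refine iInf₂_le_of_le _ ?_ le_rfl
  have hε' : (0 : ℝ) < ε := hε
  set A : ℕ → Set X := fun n => {x | ∀ r, 0 < r → r < 1 / ((n : ℝ) + 1) →
    (2 * r) ^ (d + ε / 2) ≤ μ.real (Metric.ball x r)} with hA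
  -- The exponent `d + ε / 2` in the sets `A n` lies strictly between the pointwise dimension `d`
  -- and the exponent `d + ε` of the packing measure.
  refine le_antisymm (iInf₂_le_of_le A (fun x hx => ?_) ?_) zero_le
  · exact mem_iUnion.2 (exists_nat_forall_lt_of_eventually
      ((hY x hx).eventually_rpow_le_measureReal_ball (hpos x hx) (by linarith)))
  · rw [ENNReal.tsum_eq_zero.2]
    intro n
    refine packingPremeasure_eq_zero (μ := μ) (A := A n) (ε := 1 / ((n : ℝ) + 1))
      (s := d + ε / 2) (by positivity) ?_ fun x hx => hx
    rw [NNReal.coe_add, Real.coe_toNNReal d hd]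
    linarith

/-- Exact dimensional measures have Hausdorff and packing dimension equal to the a.e. value of
their pointwise dimension. -/
theorem hasHausdorffDim_and_hasPackingDim [SecondCountableTopology X] {μ : Measure X}
    [IsFiniteMeasure μ] [NeZero μ] {d : ℝ} (hd : 0 ≤ d) (h : ∀ᵐ x ∂μ, HasPointwiseDim μ x d) :
    HasHausdorffDim μ (ENNReal.ofReal d) ∧ HasPackingDim μ (ENNReal.ofReal d) := by
  have hlow : ENNReal.ofReal d ≤ lowerDim dimH μ :=
    le_iInf fun Y => le_iInf₂ fun _ hY => le_dimH_of_hasPointwiseDim h hY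
  have hlow' : lowerDim dimH μ ≤ lowerDim dimP μ :=
    iInf_mono fun Y => iInf₂_mono fun _ _ => dimH_le_dimP Y
  have hup' : upperDim dimH μ ≤ upperDim dimP μ :=
    iInf_mono fun Y => iInf₂_mono fun _ _ => dimH_le_dimP Y
  have hup : upperDim dimP μ ≤ ENNReal.ofReal d := by
    -- Intersecting with the support guarantees that balls about the chosen points have positive
    -- mass.
    obtain ⟨Y, hY, hYm, hYsub⟩ :=
      (h.and (Measure.support_mem_ae (μ := μ))).exists_measurable_mem
    refine iInf_le_of_le Y (iInf₂_le_of_le hYm hY ?_)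
    refine dimP_le_of_hasPointwiseDim hd (fun x hx => (hYsub x hx).1) fun x hx r hr => ?_
    have := (Measure.mem_support_iff_forall x).1 (hYsub x hx).2 _ (Metric.ball_mem_nhds x hr)
    exact ENNReal.toReal_pos this.ne' (measure_ne_top _ _)
  have h1 := lowerDim_le_upperDim dimH μ
  have h2 := lowerDim_le_upperDim dimP μ
  exact ⟨⟨(h1.trans (hup'.trans hup)).antisymm hlow, (hup'.trans hup).antisymm (hlow.trans h1)⟩,
    (h2.trans hup).antisymm (hlow.trans hlow'), hup.antisymm ((hlow.trans hlow').trans h2)⟩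

end Packing

/-! ### Comparison of measures on small balls -/

section Comparison

variable {X : Type*} [MetricSpace X] [MeasurableSpace X] [BorelSpace X]
  [SecondCountableTopology X]

/-- A maximal inequality, from the Besicovitch covering theorem. -/
theorem exists_maximal_inequality (X : Type*) [MetricSpace X] [MeasurableSpace X] [BorelSpace X]
    [SecondCountableTopology X] [HasBesicovitchCovering X] :
    ∃ N : ℕ, ∀ (η ν : Measure X) (c : ℝ≥0∞) (R : ℝ) (E : Set X),
      (∀ x ∈ E, ∃ r, 0 < r ∧ r ≤ R ∧ η (Metric.closedBall x r) ≤ c * ν (Metric.closedBall x r)) →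
      η E ≤ N * (c * ν univ) := by
  obtain ⟨N, τ, hτ, hN⟩ := HasBesicovitchCovering.no_satelliteConfig (α := X)
  refine ⟨N, fun η ν c R E hE => ?_⟩
  choose! r hr0 hrR hr using hE
  let q : Besicovitch.BallPackage E X :=
    { c := fun x => x
      r := fun x => r x
      rpos := fun x => hr0 x x.2
      r_bound := R
      r_le := fun x => hrR x x.2 }
  obtain ⟨s, hs, hcov⟩ := Besicovitch.exist_disjoint_covering_families hτ hN q
  have hcount : ∀ i, (s i).Countable := fun i =>
    (hs i).countable_of_nonempty_interior fun x _ =>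
      ⟨x, Metric.ball_subset_interior_closedBall (Metric.mem_ball_self (hr0 x x.2))⟩
  -- Within one Besicovitch family the closed balls are disjoint, so their `ν`-masses add up to at
  -- most the total mass.
  have hfam : ∀ i, η (⋃ j ∈ s i, Metric.ball (q.c j) (q.r j)) ≤ c * ν univ := fun i => by
    have := (hcount i).to_subtype
    calc η (⋃ j ∈ s i, Metric.ball (q.c j) (q.r j))
        ≤ ∑' j : s i, η (Metric.ball (q.c j) (q.r j)) := measure_biUnion_le _ (hcount i) _
      _ ≤ ∑' j : s i, c * ν (Metric.closedBall (q.c j) (q.r j)) :=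
          ENNReal.tsum_le_tsum fun j =>
            (measure_mono Metric.ball_subset_closedBall).trans (hr _ (j : E).2)
      _ = c * ν (⋃ j ∈ s i, Metric.closedBall (q.c j) (q.r j)) := by
          rw [ENNReal.tsum_mul_left, measure_biUnion (hcount i) (hs i)
            fun j _ => Metric.isClosed_closedBall.measurableSet]
      _ ≤ c * ν univ := mul_le_mul_right (measure_mono (subset_univ _)) _
  have hsub : E ⊆ ⋃ i, ⋃ j ∈ s i, Metric.ball (q.c j) (q.r j) := fun x hx =>
    hcov ⟨⟨x, hx⟩, rfl⟩
  calc η E ≤ ∑ i : Fin N, η (⋃ j ∈ s i, Metric.ball (q.c j) (q.r j)) :=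
        (measure_mono hsub).trans (measure_iUnion_fintype_le _ _)
    _ ≤ ∑ i : Fin N, c * ν univ := Finset.sum_le_sum fun i _ => hfam i
    _ = N * (c * ν univ) := by simp

omit [BorelSpace X] in
theorem ae_measureReal_closedBall_pos (η : Measure X) [IsFiniteMeasure η] :
    ∀ᵐ x ∂η, ∀ r > 0, 0 < η.real (Metric.closedBall x r) := by
  filter_upwards [Measure.support_mem_ae (μ := η)] with x hx r hr
  exact ENNReal.toReal_pos
    ((Measure.mem_support_iff_forall x).1 hx _ (Metric.closedBall_mem_nhds x hr)).ne'
    (measure_ne_top _ _)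

/-- The ratio `η(B) / ν(B)` converges to the density of `η` with respect to `ν`, which is positive
and finite `η`-almost everywhere, so logarithms may be taken. -/
theorem ae_exists_tendsto_log_sub_log [HasBesicovitchCovering X] {η ν : Measure X}
    [IsFiniteMeasure η] [IsFiniteMeasure ν] (h : η ≤ ν) :
    ∀ᵐ x ∂η, ∃ L, Tendsto (fun r => Real.log (ν.real (Metric.closedBall x r)) -
      Real.log (η.real (Metric.closedBall x r))) (𝓝[>] 0) (𝓝 L) := by
  have hac : η ≪ ν := Measure.absolutelyContinuous_of_le h
  filter_upwards [hac.ae_le (Besicovitch.ae_tendsto_rnDeriv η ν), Measure.rnDeriv_pos hac,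
    hac.ae_le (Measure.rnDeriv_lt_top η ν), ae_measureReal_closedBall_pos η]
    with x hlim hpos hfin hball
  refine ⟨-Real.log (η.rnDeriv ν x).toReal, ?_⟩
  have h1 := ((ENNReal.tendsto_toReal hfin.ne).comp hlim).log
    (ENNReal.toReal_pos hpos.ne' hfin.ne).ne'
  refine h1.neg.congr' ?_
  filter_upwards [self_mem_nhdsWithin] with r hr
  have h2 := hball r hr
  have h3 : 0 < ν.real (Metric.closedBall x r) :=
    h2.trans_le (ENNReal.toReal_mono (measure_ne_top _ _) (h _))
  rw [Function.comp_apply, ENNReal.toReal_div, ← measureReal_def, ← measureReal_def,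
    Real.log_div h2.ne' h3.ne', neg_sub]

end Comparison

/-! ### Integrability of the maximal logarithmic ratio -/

section LayerCake

variable {Ω : Type*} [MeasurableSpace Ω]

/-- The bound is shaped so that, applied to cells of mass `q_j`, it sums to the entropy of `Q` plus
a constant. -/
theorem lintegral_le_of_exponential_tail {η : Measure Ω} [IsFiniteMeasure η] {F : Ω → ℝ≥0∞}
    (hF : Measurable F) {N : ℕ} (hq0 : 0 < η.real univ) (hq1 : η.real univ ≤ 1)
    (htail : ∀ s : ℝ, 0 < s → η {ω | ENNReal.ofReal s < F ω} ≤ N * ENNReal.ofReal (Real.exp (-s))) :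
    ∫⁻ ω, F ω ∂η ≤ ENNReal.ofReal (-(η.real univ * Real.log (η.real univ)) + N * η.real univ) := by
  set q := η.real univ with hq
  have hfin : ∀ᵐ ω ∂η, F ω ≠ ⊤ := by
    have hlim : Tendsto (fun s : ℝ => (N : ℝ≥0∞) * ENNReal.ofReal (Real.exp (-s))) atTop (𝓝 0) := by
      have := ENNReal.Tendsto.const_mul (a := (N : ℝ≥0∞))
        (ENNReal.tendsto_ofReal (Real.tendsto_exp_atBot.comp tendsto_neg_atTop_atBot))
        (.inr (ENNReal.natCast_ne_top N))
      simpa using this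
    refine le_antisymm (ge_of_tendsto hlim ?_) zero_le
    filter_upwards [eventually_gt_atTop 0] with s hs
    refine (measure_mono fun ω hω => ?_).trans (htail s hs)
    have : F ω = ⊤ := not_not.1 hω
    change ENNReal.ofReal s < F ω
    rw [this]
    exact ENNReal.ofReal_lt_top
  have hlc := lintegral_eq_lintegral_meas_lt η (f := fun ω => (F ω).toReal)
    (Eventually.of_forall fun ω => ENNReal.toReal_nonneg) hF.ennreal_toReal.aemeasurable
  have hcong : ∫⁻ ω, F ω ∂η = ∫⁻ ω, ENNReal.ofReal (F ω).toReal ∂η :=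
    lintegral_congr_ae (hfin.mono fun ω hω => (ENNReal.ofReal_toReal hω).symm)
  rw [hcong, hlc]
  -- The layer-cake integral is cut where `exp (-a) = q`: below `a` the trivial tail bound `q` gives
  -- `-q log q`, above it the exponential tail integrates to `N q`.
  set a := -Real.log q with ha
  have ha0 : 0 ≤ a := neg_nonneg.2 (Real.log_nonpos hq0.le hq1)
  have hexp : Real.exp (-a) = q := by rw [ha, neg_neg, Real.exp_log hq0]
  rw [← Ioc_union_Ioi_eq_Ioi ha0,
    lintegral_union measurableSet_Ioi (Ioc_disjoint_Ioi le_rfl)]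
  have h1 : ∫⁻ t in Ioc 0 a, η {ω | t < (F ω).toReal} ≤ ENNReal.ofReal (-(q * Real.log q)) := by
    calc ∫⁻ t in Ioc 0 a, η {ω | t < (F ω).toReal}
        ≤ ∫⁻ _t in Ioc 0 a, ENNReal.ofReal q := lintegral_mono fun t => by
          rw [hq, ofReal_measureReal]; exact measure_mono (subset_univ _)
      _ = ENNReal.ofReal (-(q * Real.log q)) := by
          rw [setLIntegral_const, Real.volume_Ioc, ← ENNReal.ofReal_mul hq0.le, ha]
          congr 1; ring
  have h2 : ∫⁻ t in Ioi a, η {ω | t < (F ω).toReal} ≤ ENNReal.ofReal (N * q) := by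
    calc ∫⁻ t in Ioi a, η {ω | t < (F ω).toReal}
        ≤ ∫⁻ t in Ioi a, N * ENNReal.ofReal (Real.exp (-t)) := by
          refine setLIntegral_mono' measurableSet_Ioi fun t ht => ?_
          have ht0 : 0 < t := ha0.trans_lt ht
          refine (measure_mono fun ω hω => ?_).trans (htail t ht0)
          have hω' : t < (F ω).toReal := hω
          have hne : F ω ≠ ⊤ := fun h => by
            rw [h, ENNReal.toReal_top] at hω'
            exact (ht0.trans hω').false
          exact (ENNReal.ofReal_lt_iff_lt_toReal ht0.le hne).2 hω'
      _ = N * ENNReal.ofReal (∫ t in Ioi a, Real.exp (-t)) := by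
          rw [lintegral_const_mul' _ _ (ENNReal.natCast_ne_top N),
            ofReal_integral_eq_lintegral_ofReal (integrableOn_exp_neg_Ioi a)
            (Eventually.of_forall fun t => (Real.exp_pos _).le)]
      _ = ENNReal.ofReal (N * q) := by
          rw [integral_exp_neg_Ioi, hexp, ENNReal.ofReal_mul (Nat.cast_nonneg N),
            ENNReal.ofReal_natCast]
  rw [ENNReal.ofReal_add _ (by positivity)]
  · exact add_le_add h1 h2
  · have := Real.log_nonpos hq0.le hq1
    nlinarith

/-- The logarithmic ratios of the measures of balls are dominated by an integrable function. -/
theorem exists_lintegral_iSup_log_le : ∃ N : ℕ, ∀ (η : Measure Ω) [IsFiniteMeasure η]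
    (ν : Measure ℝ) [IsProbabilityMeasure ν] (f : Ω → ℝ) (r : ℕ → Ω → ℝ) (R : ℝ),
    Measurable f → η.map f ≤ ν → (∀ n ω, 0 < r n ω) → (∀ n ω, r n ω ≤ R) →
    (∀ n, Measurable fun ω => Real.log (ν.real (Metric.closedBall (f ω) (r n ω))) -
      Real.log ((η.map f).real (Metric.closedBall (f ω) (r n ω)))) →
    0 < η.real univ → η.real univ ≤ 1 →
    ∫⁻ ω, ⨆ n, ENNReal.ofReal (Real.log (ν.real (Metric.closedBall (f ω) (r n ω))) -
      Real.log ((η.map f).real (Metric.closedBall (f ω) (r n ω)))) ∂η ≤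
      ENNReal.ofReal (-(η.real univ * Real.log (η.real univ)) + N * η.real univ) := by
  obtain ⟨N, hN⟩ := exists_maximal_inequality ℝ
  refine ⟨N, fun η _ ν _ f r R hf hle hr0 hrR hm hq0 hq1 => ?_⟩
  refine lintegral_le_of_exponential_tail (Measurable.iSup fun n => (hm n).ennreal_ofReal) hq0 hq1
    fun s hs => ?_
  -- A logarithmic ratio above `s` at some radius puts the point in `E`, to which the maximal
  -- inequality applies with constant `exp (-s)`.
  set E : Set ℝ := {x | ∃ r, 0 < r ∧ r ≤ R ∧ (η.map f) (Metric.closedBall x r) ≤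
    ENNReal.ofReal (Real.exp (-s)) * ν (Metric.closedBall x r)} with hE
  have hsub : {ω | ENNReal.ofReal s < ⨆ n,
      ENNReal.ofReal (Real.log (ν.real (Metric.closedBall (f ω) (r n ω))) -
        Real.log ((η.map f).real (Metric.closedBall (f ω) (r n ω))))} ⊆ f ⁻¹' E := by
    intro ω hω
    obtain ⟨n, hn⟩ := lt_iSup_iff.1 (show ENNReal.ofReal s < ⨆ n,
      ENNReal.ofReal (Real.log (ν.real (Metric.closedBall (f ω) (r n ω))) -
        Real.log ((η.map f).real (Metric.closedBall (f ω) (r n ω)))) from hω)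
    refine ⟨r n ω, hr0 n ω, hrR n ω, ?_⟩
    rw [ENNReal.ofReal_lt_ofReal_iff_of_nonneg hs.le] at hn
    rw [← ofReal_measureReal (μ := ν), ← ofReal_measureReal (μ := η.map f),
      ← ENNReal.ofReal_mul (Real.exp_pos _).le]
    refine ENNReal.ofReal_le_ofReal ?_
    set A := ν.real (Metric.closedBall (f ω) (r n ω)) with hA
    set B := (η.map f).real (Metric.closedBall (f ω) (r n ω)) with hB
    have hA0 : 0 ≤ A := measureReal_nonneg
    have hB0 : 0 ≤ B := measureReal_nonneg
    rcases hB0.eq_or_lt with hB0 | hB0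
    · rw [← hB0]; positivity
    rcases hA0.eq_or_lt with hA0 | hA0
    · exfalso
      have : B ≤ A := ENNReal.toReal_mono (measure_ne_top _ _) (hle _)
      linarith
    · rw [← Real.log_le_log_iff hB0 (by positivity), Real.log_mul (Real.exp_pos _).ne' hA0.ne',
        Real.log_exp]
      linarith
  calc η _ ≤ η (f ⁻¹' E) := measure_mono hsub
    -- This inequality holds for outer measures, so no measurability of `E` is required.
    _ ≤ (η.map f) E := Measure.le_map_apply hf.aemeasurable E
    _ ≤ N * (ENNReal.ofReal (Real.exp (-s)) * ν univ) := hN _ _ _ R E fun x hx => hx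
    _ = N * ENNReal.ofReal (Real.exp (-s)) := by rw [measure_univ, mul_one]

end LayerCake

/-! ### Pointwise dimensions along sequences of radii -/

section Sequences

theorem exists_lt_le_of_antitone {R : ℕ → ℝ} (hR : Antitone R) (hlim : Tendsto R atTop (𝓝 0))
    {N : ℕ} {r : ℝ} (hr0 : 0 < r) (hrN : r ≤ R N) : ∃ n ≥ N, R (n + 1) < r ∧ r ≤ R n := by
  have hex : ∃ m, R m < r := (hlim.eventually_lt_const hr0).exists
  classical
  have hm := Nat.find_spec hex
  have hNm : N < Nat.find hex := by
    by_contra! hle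
    exact absurd (hm.trans_le hrN) (hR hle).not_gt
  obtain ⟨n, hn⟩ := Nat.exists_eq_add_of_lt (Nat.zero_lt_of_lt hNm)
  rw [zero_add] at hn
  refine ⟨n, by omega, hn ▸ hm, not_lt.1 (Nat.find_min hex (m := n) (by omega))⟩

variable {X : Type*} [PseudoMetricSpace X] [MeasurableSpace X] {μ : Measure X} {x : X}
  {R G : ℕ → ℝ}

/-- For `R (n + 1) < r ≤ R n` the quotient lies between `log G n / log R (n + 1)` and `log G (n + 1)
/ log R n`. No bound on `R n / R (n + 1)` is assumed, which matters when the ratios `ρ i` accumulate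
at `0`. -/
theorem hasPointwiseDim_of_tendsto_ratio {d : ℝ} (hR0 : ∀ n, 0 < R n) (hR : Antitone R)
    (hlim : Tendsto R atTop (𝓝 0)) (hG0 : ∀ n, 0 < G n) (hG1 : ∀ n, G n ≤ 1)
    (hG : ∀ n r, R (n + 1) < r → r ≤ R n →
      G (n + 1) ≤ μ.real (Metric.ball x r) ∧ μ.real (Metric.ball x r) ≤ G n)
    (h1 : Tendsto (fun n => Real.log (G n) / Real.log (R (n + 1))) atTop (𝓝 d))
    (h2 : Tendsto (fun n => Real.log (G (n + 1)) / Real.log (R n)) atTop (𝓝 d)) :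
    HasPointwiseDim μ x d := by
  refine Metric.tendsto_nhds.2 fun ε hε => ?_
  obtain ⟨N, hN⟩ := eventually_atTop.1 (((hlim.eventually_lt_const one_pos).and
    (Metric.tendsto_nhds.1 h1 ε hε)).and (Metric.tendsto_nhds.1 h2 ε hε))
  filter_upwards [Ioc_mem_nhdsGT (hR0 N)] with r hr
  obtain ⟨n, hn, hlt, hle⟩ := exists_lt_le_of_antitone hR hlim hr.1 hr.2
  obtain ⟨⟨hR1, ha⟩, hb⟩ := hN n hn
  obtain ⟨hGl, hGu⟩ := hG n r hlt hle
  set M := μ.real (Metric.ball x r) with hM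
  have hM0 : 0 < M := (hG0 _).trans_le hGl
  have l1 : Real.log (G (n + 1)) ≤ Real.log M := Real.log_le_log (hG0 _) hGl
  have l2 : Real.log M ≤ Real.log (G n) := Real.log_le_log hM0 hGu
  have l3 : Real.log (G n) ≤ 0 := Real.log_nonpos (hG0 n).le (hG1 n)
  have l4 : Real.log (R (n + 1)) ≤ Real.log r := Real.log_le_log (hR0 _) hlt.le
  have l5 : Real.log r ≤ Real.log (R n) := Real.log_le_log hr.1 hle
  have l6 : Real.log (R n) < 0 := Real.log_neg (hR0 n) hR1
  have u1 : Real.log M / Real.log r ≤ Real.log (G (n + 1)) / Real.log (R n) := by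
    rw [← neg_div_neg_eq, ← neg_div_neg_eq (Real.log (G (n + 1)))]
    exact div_le_div₀ (by linarith) (by linarith) (by linarith) (by linarith)
  have u2 : Real.log (G n) / Real.log (R (n + 1)) ≤ Real.log M / Real.log r := by
    rw [← neg_div_neg_eq, ← neg_div_neg_eq (Real.log M)]
    exact div_le_div₀ (by linarith) (by linarith) (by linarith) (by linarith)
  rw [Real.dist_eq, abs_lt] at ha hb ⊢
  constructor <;> linarith

/-- Both sequences are normalised by `n`, so a shift of index costs only a factor `n / (n + 1) → 1`
or its inverse. The filter `l` is left free to cover finite and infinite Lyapunov exponents at once.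
-/
theorem tendsto_div_succ {A B : ℕ → ℝ} {h d : ℝ} {l : Filter ℝ}
    (hA : Tendsto (fun n : ℕ => A n / n) atTop (𝓝 h))
    (hB : Tendsto (fun n : ℕ => B n / n) atTop l)
    (hdiv : Tendsto (fun x : ℝ × ℝ => x.1 / x.2) (𝓝 h ×ˢ l) (𝓝 d)) :
    Tendsto (fun n => A n / B (n + 1)) atTop (𝓝 d) ∧
      Tendsto (fun n => A (n + 1) / B n) atTop (𝓝 d) := by
  have hA' := hA.comp (tendsto_add_atTop_nat 1)
  have hB' := hB.comp (tendsto_add_atTop_nat 1)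
  have hn : Tendsto (fun n : ℕ => (n : ℝ) / (n + 1)) atTop (𝓝 1) :=
    tendsto_natCast_div_add_atTop 1
  constructor
  · have := (hdiv.comp (hA.prodMk hB')).mul hn
    rw [mul_one] at this
    refine this.congr' ?_
    filter_upwards [eventually_gt_atTop 0] with n hn0
    have hn0' : (n : ℝ) ≠ 0 := by positivity
    have hn1 : (n : ℝ) + 1 ≠ 0 := by positivity
    simp only [Function.comp_apply, Nat.cast_add, Nat.cast_one]
    rcases eq_or_ne (B (n + 1)) 0 with h0 | h0
    · simp [h0]
    · field_simp
  · have := (hdiv.comp (hA'.prodMk hB)).mul (hn.inv₀ one_ne_zero)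
    rw [inv_one, mul_one] at this
    refine this.congr' ?_
    filter_upwards [eventually_gt_atTop 0] with n hn0
    have hn0' : (n : ℝ) ≠ 0 := by positivity
    have hn1 : (n : ℝ) + 1 ≠ 0 := by positivity
    simp only [Function.comp_apply, Nat.cast_add, Nat.cast_one]
    rcases eq_or_ne (B n) 0 with h0 | h0
    · simp [h0]
    · field_simp

/-- Exponential decay of the measures of balls along exponentially decaying radii. -/
theorem hasPointwiseDim_of_tendsto_div {h d : ℝ} {l : Filter ℝ} (hR0 : ∀ n, 0 < R n)
    (hR : Antitone R) (hlim : Tendsto R atTop (𝓝 0)) (hG0 : ∀ n, 0 < G n) (hG1 : ∀ n, G n ≤ 1)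
    (hG : ∀ n r, R (n + 1) < r → r ≤ R n →
      G (n + 1) ≤ μ.real (Metric.ball x r) ∧ μ.real (Metric.ball x r) ≤ G n)
    (hA : Tendsto (fun n : ℕ => -Real.log (G n) / n) atTop (𝓝 h))
    (hB : Tendsto (fun n : ℕ => -Real.log (R n) / n) atTop l)
    (hdiv : Tendsto (fun x : ℝ × ℝ => x.1 / x.2) (𝓝 h ×ˢ l) (𝓝 d)) :
    HasPointwiseDim μ x d := by
  obtain ⟨h1, h2⟩ := tendsto_div_succ hA hB hdiv
  simp only [neg_div_neg_eq] at h1 h2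
  exact hasPointwiseDim_of_tendsto_ratio hR0 hR hlim hG0 hG1 hG h1 h2

theorem tendsto_div_prod_nhds {h χ : ℝ} (hχ : χ ≠ 0) :
    Tendsto (fun x : ℝ × ℝ => x.1 / x.2) (𝓝 h ×ˢ 𝓝 χ) (𝓝 (h / χ)) :=
  tendsto_fst.div tendsto_snd hχ

theorem tendsto_div_prod_atTop {h : ℝ} :
    Tendsto (fun x : ℝ × ℝ => x.1 / x.2) (𝓝 h ×ˢ atTop) (𝓝 0) :=
  tendsto_fst.div_atTop tendsto_snd

end Sequences

/-! ### From almost every code to almost every point -/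

section Transfer

variable {Ω : Type*} [MeasurableSpace Ω] {μ : Measure Ω} [IsProbabilityMeasure μ] {f : Ω → ℝ}

/-- Transfer along `map` is made through a measurable set: the dimension condition is restricted to
the radii `2 ^ (-n)`, transferred, and then extended to all radii on the support. -/
theorem ae_map_hasPointwiseDim (hf : Measurable f) {d : ℝ}
    (h : ∀ᵐ ω ∂μ, HasPointwiseDim (μ.map f) (f ω) d) :
    ∀ᵐ x ∂μ.map f, HasPointwiseDim (μ.map f) x d := by
  have : IsProbabilityMeasure (μ.map f) := Measure.isProbabilityMeasure_map hf.aemeasurable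
  set R : ℕ → ℝ := fun n => (1 / 2) ^ n with hR
  have hR0 : ∀ n, 0 < R n := fun n => by positivity
  have hRlim : Tendsto R atTop (𝓝 0) :=
    tendsto_pow_atTop_nhds_zero_of_lt_one (by norm_num) (by norm_num)
  have hRanti : Antitone R := pow_right_anti₀ (by norm_num) (by norm_num)
  set S : Set ℝ := {x | Tendsto (fun n => Real.log ((μ.map f).real (Metric.ball x (R n))) /
    Real.log (R n)) atTop (𝓝 d)} with hS
  have hSm : MeasurableSet S := by
    refine measurableSet_tendsto _ fun n => ?_
    have hm : Measurable fun x : ℝ => (μ.map f) (Metric.ball x (R n)) := by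
      have hset : MeasurableSet {z : ℝ × ℝ | dist z.2 z.1 < R n} :=
        measurableSet_lt (measurable_snd.dist measurable_fst) measurable_const
      exact measurable_measure_prodMk_left hset
    exact hm.ennreal_toReal.log.div_const _
  have hRgt : Tendsto R atTop (𝓝[>] 0) :=
    tendsto_nhdsWithin_iff.2 ⟨hRlim, Eventually.of_forall hR0⟩
  have hSae : ∀ᵐ x ∂μ.map f, x ∈ S := by
    refine (ae_map_iff (p := fun x => x ∈ S) hf.aemeasurable hSm).2 ?_
    filter_upwards [h] with ω hω
    exact hω.comp hRgt
  filter_upwards [hSae, Measure.support_mem_ae (μ := μ.map f)] with x hxS hx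
  have hlog : ∀ n, -Real.log (R n) / n * n = n * Real.log 2 := fun n => by
    rcases eq_or_ne (n : ℝ) 0 with h0 | h0
    · simp [h0]
    · rw [div_mul_cancel₀ _ h0, hR]
      simp [Real.log_pow]
  have hB : Tendsto (fun n : ℕ => -Real.log (R n) / n) atTop (𝓝 (Real.log 2)) := by
    refine tendsto_const_nhds.congr' ?_
    filter_upwards [eventually_gt_atTop 0] with n hn
    have hn' : (n : ℝ) ≠ 0 := by positivity
    have := hlog n
    field_simp at this ⊢
    linarith
  have hlog2 : Real.log 2 ≠ 0 := (Real.log_pos one_lt_two).ne'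
  have hA : Tendsto (fun n : ℕ => -Real.log ((μ.map f).real (Metric.ball x (R n))) / n) atTop
      (𝓝 (d * Real.log 2)) := by
    refine (Tendsto.mul hxS hB).congr' ?_
    filter_upwards [eventually_gt_atTop 0] with n hn
    have hn' : (n : ℝ) ≠ 0 := by positivity
    have hRn : Real.log (R n) ≠ 0 :=
      (Real.log_neg (hR0 n) (pow_lt_one₀ (by norm_num) (by norm_num) hn.ne')).ne
    field_simp
  have hd : d = d * Real.log 2 / Real.log 2 := by field_simp
  rw [hd]
  refine hasPointwiseDim_of_tendsto_div hR0 hRanti hRlim (fun n => ?_)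
    (fun n => measureReal_le_one) (fun n r h1 h2 => ⟨?_, ?_⟩) hA hB (tendsto_div_prod_nhds hlog2)
  · exact ENNReal.toReal_pos ((Measure.mem_support_iff_forall x).1 hx _
      (Metric.ball_mem_nhds x (hR0 n))).ne' (measure_ne_top _ _)
  · exact measureReal_mono (Metric.ball_subset_ball h1.le)
  · exact measureReal_mono (Metric.ball_subset_ball h2)

end Transfer

/-! ### Independence and laws of single letters -/

section Bernoulli

theorem bernoulliOneSided_eval_zero (q : PMF ℕ+) (j : ℕ+) :
    bernoulliOneSided q {w | w 0 = j} = q j := by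
  have h1 := congrArg (fun m => m {j}) (map_eval_bernoulliOneSided q 0)
  rw [Measure.map_apply (measurable_pi_apply 0) (measurableSet_singleton j),
    PMF.toMeasure_apply_singleton _ _ (measurableSet_singleton j)] at h1
  exact h1

theorem bernoulliOneSided_inter_preimage_sigma (q : PMF ℕ+) (j : ℕ+) {B : Set Code}
    (hB : MeasurableSet B) :
    bernoulliOneSided q ({w | w 0 = j} ∩ sigma ⁻¹' B) = q j * bernoulliOneSided q B := by
  set s : ℕ → MeasurableSpace Code := fun k =>
    MeasurableSpace.comap (fun w : Code => w k) inferInstance with hs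
  have hind : iIndep s (bernoulliOneSided q) :=
    iIndepFun_infinitePi (P := fun _ : ℕ => q.toMeasure) (X := fun _ i => i) fun _ => measurable_id
  have h := indep_biSup_compl (fun k => (measurable_pi_apply k).comap_le) hind {0}
  rw [Indep_iff] at h
  rw [h {w | w 0 = j} (sigma ⁻¹' B) ?_ ?_, bernoulliOneSided_eval_zero,
    (measurePreserving_sigma q).measure_preimage hB.nullMeasurableSet]
  · refine MeasurableSpace.le_def.1 (le_iSup₂ (f := fun i (_ : i ∈ ({0} : Set ℕ)) => s i) 0 rfl) _ ?_
    exact ⟨{j}, measurableSet_singleton j, rfl⟩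
  · have hm : Measurable[⨆ k ∈ ({0} : Set ℕ)ᶜ, s k] sigma := by
      refine @measurable_pi_lambda _ _ _ (⨆ k ∈ ({0} : Set ℕ)ᶜ, s k) _ _ fun k => ?_
      exact (comap_measurable (fun w : Code => w (k + 1))).mono
        (le_iSup₂ (f := fun i (_ : i ∈ ({0} : Set ℕ)ᶜ) => s i) (k + 1) (Nat.succ_ne_zero k)) le_rfl
    exact hm hB

theorem measurable_eval_eval : Measurable fun z : Code × Code => z.1 ((z.2 0 : ℕ+) : ℕ) := by
  have h : Measurable fun x : Code × ℕ+ => x.1 (x.2 : ℕ) :=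
    measurable_from_prod_countable_left fun j => measurable_pi_apply (j : ℕ)
  exact h.comp (measurable_fst.prodMk ((measurable_pi_apply 0).comp measurable_snd))

/-- With `ω` fixed, the letter of `λ` at the index prescribed by `ω` has law `P`. Hence the Lyapunov
exponent depends on `P` alone. -/
theorem map_eval_eval (p q : PMF ℕ+) :
    ((bernoulliOneSided p).prod (bernoulliOneSided q)).map
      (fun z => z.1 ((z.2 0 : ℕ+) : ℕ)) = p.toMeasure := by
  ext A hA
  rw [Measure.map_apply measurable_eval_eval hA,
    Measure.prod_apply_symm (measurable_eval_eval hA)]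
  have : ∀ w : Code, bernoulliOneSided p ((fun l => (l, w)) ⁻¹'
      ((fun z : Code × Code => z.1 ((z.2 0 : ℕ+) : ℕ)) ⁻¹' A)) = p.toMeasure A := fun w => by
    rw [← map_eval_bernoulliOneSided p ((w 0 : ℕ+) : ℕ),
      Measure.map_apply (f := fun l : Code => l ((w 0 : ℕ+) : ℕ))
        (measurable_pi_apply ((w 0 : ℕ+) : ℕ)) hA]
    rfl
  simp [this]

end Bernoulli

/-! ### Integrals with respect to a probability vector -/

section ProbabilityVector

theorem PMF.lintegral_toMeasure (p : PMF ℕ+) (g : ℕ+ → ℝ≥0∞) :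
    ∫⁻ i, g i ∂p.toMeasure = ∑' i, g i * p i := by
  rw [lintegral_countable']
  exact tsum_congr fun i => by
    rw [PMF.toMeasure_apply_singleton _ _ (measurableSet_singleton i)]

theorem PMF.integrable_toMeasure_iff (p : PMF ℕ+) (g : ℕ+ → ℝ) :
    Integrable g p.toMeasure ↔ Summable fun i => (p i).toReal * g i := by
  have hterm : ∀ i, ‖g i‖ₑ * p i = ENNReal.ofReal |(p i).toReal * g i| := fun i => by
    rw [abs_mul, abs_of_nonneg ENNReal.toReal_nonneg, mul_comm, ENNReal.ofReal_mul
      ENNReal.toReal_nonneg, ENNReal.ofReal_toReal (p.apply_ne_top i), Real.enorm_eq_ofReal_abs]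
  have hfin : HasFiniteIntegral g p.toMeasure ↔ Summable fun i => (p i).toReal * g i := by
    rw [HasFiniteIntegral, PMF.lintegral_toMeasure, tsum_congr hterm, lt_top_iff_ne_top,
      ← summable_abs_iff]
    exact ⟨fun h => by
      have := ENNReal.summable_toReal h
      simpa only [ENNReal.toReal_ofReal (abs_nonneg _)] using this,
      fun h => h.tsum_ofReal_ne_top⟩
  exact ⟨fun h => hfin.1 h.2, fun h => ⟨measurable_from_top.aestronglyMeasurable, hfin.2 h⟩⟩

theorem PMF.integral_toMeasure (p : PMF ℕ+) {g : ℕ+ → ℝ}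
    (h : Summable fun i => (p i).toReal * g i) :
    ∫ i, g i ∂p.toMeasure = ∑' i, (p i).toReal * g i := by
  rw [PMF.integral_eq_tsum p g ((PMF.integrable_toMeasure_iff p g).2 h)]
  rfl

end ProbabilityVector

/-! ### Masses of balls along the orbits of a random system of similarities -/

section System

/-- The contraction ratio of the first map applied. -/
def ratio (ρ : ℕ+ → ℝ) (z : Code × Code) : ℝ := ρ (z.1 ((z.2 0 : ℕ+) : ℕ))

/-- The product of `R` with the first `n` contraction ratios. -/
def radius (ρ : ℕ+ → ℝ) (R : ℝ) : ℕ → Code × Code → ℝ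
  | 0, _ => R
  | n + 1, z => ratio ρ z * radius ρ R n (skew z)

/-- `f` is a measurable fibrewise projection onto the limit set of a random system of similarities
with contraction ratios `ratio ρ` acting on `[a, b]`. -/
structure IsFiberProjection (ρ : ℕ+ → ℝ) (a b : ℝ) (f : Code × Code → ℝ) : Prop where
  measurable : Measurable f
  mem_Icc : ∀ z, f z ∈ Icc a b
  exists_eq : ∃ c : Code → ℝ, ∀ z, f z = ratio ρ z * f (skew z) + c z.1

/-- The projection of the Bernoulli measure to the fibre over `l`. -/
noncomputable def fiberMeasure (q : PMF ℕ+) (f : Code × Code → ℝ) (l : Code) : Measure ℝ :=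
  (bernoulliOneSided q).map fun w => f (l, w)

/-- The part of `fiberMeasure` carried by the codes with first letter `j`. -/
noncomputable def cellMeasure (q : PMF ℕ+) (f : Code × Code → ℝ) (l : Code) (j : ℕ+) : Measure ℝ :=
  ((bernoulliOneSided q).restrict {w | w 0 = j}).map fun w => f (l, w)

/-- The mass of the ball of radius `radius ρ R n z` around `f z`. -/
noncomputable def ballMass (ρ : ℕ+ → ℝ) (R : ℝ) (q : PMF ℕ+) (f : Code × Code → ℝ) (n : ℕ)
    (z : Code × Code) : ℝ :=
  (fiberMeasure q f z.1).real (Metric.closedBall (f z) (radius ρ R n z))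

/-- The conditional information of the first letter given a ball. -/
noncomputable def ballInfo (ρ : ℕ+ → ℝ) (R : ℝ) (q : PMF ℕ+) (f : Code × Code → ℝ) (n : ℕ)
    (z : Code × Code) : ℝ :=
  Real.log (ballMass ρ R q f (n + 1) z) -
    Real.log ((q (z.2 0)).toReal * ballMass ρ R q f n (skew z))

variable {ρ : ℕ+ → ℝ} {r : ℝ} {a b R : ℝ} {f : Code × Code → ℝ} {q : PMF ℕ+}

theorem measurableSet_eval_zero (j : ℕ+) : MeasurableSet {w : Code | w 0 = j} :=
  measurable_pi_apply (X := fun _ : ℕ => ℕ+) 0 (measurableSet_singleton j)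

theorem measurable_measureReal_closedBall {Ω : Type*} [MeasurableSpace Ω] {M : Measure ℝ}
    [SFinite M] {x s : Ω → ℝ} (hx : Measurable x) (hs : Measurable s) :
    Measurable fun ω => M.real (Metric.closedBall (x ω) (s ω)) := by
  have hset : MeasurableSet {y : Ω × ℝ | dist y.2 (x y.1) ≤ s y.1} :=
    measurableSet_le (measurable_snd.dist (hx.comp measurable_fst)) (hs.comp measurable_fst)
  exact (measurable_measure_prodMk_left (ν := M) hset).ennreal_toReal

theorem measurable_skew : Measurable skew :=
  (measurable_sigma.comp measurable_fst).prodMk (measurable_sigma.comp measurable_snd)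

theorem measurable_ratio : Measurable (ratio ρ) :=
  (measurable_from_top (f := ρ)).comp measurable_eval_eval

theorem measurable_radius (n : ℕ) : Measurable (radius ρ R n) := by
  induction n with
  | zero => exact measurable_const
  | succ n ih => exact measurable_ratio.mul (ih.comp measurable_skew)

theorem radius_pos (hρ : ∀ i, 0 < ρ i ∧ ρ i < r) (hR : 0 < R) (n : ℕ) (z : Code × Code) :
    0 < radius ρ R n z := by
  induction n generalizing z with
  | zero => exact hR
  | succ n ih => exact mul_pos (hρ _).1 (ih _)

theorem radius_le (hρ : ∀ i, 0 < ρ i ∧ ρ i < r) (hR : 0 < R) (n : ℕ) (z : Code × Code) :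
    radius ρ R n z ≤ r ^ n * R := by
  induction n generalizing z with
  | zero => simp [radius]
  | succ n ih =>
    rw [pow_succ', mul_assoc]
    exact mul_le_mul (hρ _).2.le (ih _) (radius_pos hρ hR n _).le ((hρ 1).1.trans (hρ 1).2).le

theorem radius_succ_le (hr : r < 1) (hρ : ∀ i, 0 < ρ i ∧ ρ i < r) (hR : 0 < R) (n : ℕ)
    (z : Code × Code) : radius ρ R (n + 1) z ≤ radius ρ R n z := by
  induction n generalizing z with
  | zero => exact mul_le_of_le_one_left hR.le ((hρ _).2.trans hr).le
  | succ n ih => exact mul_le_mul_of_nonneg_left (ih _) (hρ _).1.le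

theorem tendsto_radius (hr : r < 1) (hρ : ∀ i, 0 < ρ i ∧ ρ i < r) (hR : 0 < R)
    (z : Code × Code) : Tendsto (fun n => radius ρ R n z) atTop (𝓝 0) := by
  have h0 : Tendsto (fun n : ℕ => r ^ n * R) atTop (𝓝 0) := by
    simpa using (tendsto_pow_atTop_nhds_zero_of_lt_one ((hρ 1).1.trans (hρ 1).2).le hr).mul_const R
  exact squeeze_zero (fun n => (radius_pos hρ hR n z).le) (fun n => radius_le hρ hR n z) h0

theorem neg_log_radius (hρ : ∀ i, 0 < ρ i ∧ ρ i < r) (hR : 0 < R) (n : ℕ) (z : Code × Code) :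
    -Real.log (radius ρ R n z) =
      birkhoffSum skew (fun z => -Real.log (ratio ρ z)) n z - Real.log R := by
  induction n generalizing z with
  | zero => simp [radius]
  | succ n ih =>
    rw [radius, Real.log_mul (show ratio ρ z ≠ 0 from (hρ _).1.ne') (radius_pos hρ hR n _).ne', birkhoffSum_succ', neg_add, ih]
    ring

namespace IsFiberProjection

variable (hf : IsFiberProjection ρ a b f)
include hf

theorem measurable_section (l : Code) : Measurable fun w => f (l, w) :=
  hf.measurable.comp measurable_prodMk_left

theorem isProbabilityMeasure_fiberMeasure (l : Code) : IsProbabilityMeasure (fiberMeasure q f l) :=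
  Measure.isProbabilityMeasure_map (hf.measurable_section l).aemeasurable

theorem cellMeasure_le (l : Code) (j : ℕ+) : cellMeasure q f l j ≤ fiberMeasure q f l :=
  Measure.map_mono Measure.restrict_le_self (hf.measurable_section l)

/-- The translation depends on the fibre only, so it cancels in differences: on codes sharing the
first letter of `z`, distances to `f z` are exactly `ratio ρ z` times those after one shift.
Independence of the first letter then produces the factor `q (z.2 0)`. -/
theorem cellMeasure_closedBall (hρ : ∀ i, 0 < ρ i ∧ ρ i < r) (z : Code × Code) (s : ℝ) :
    cellMeasure q f z.1 (z.2 0) (Metric.closedBall (f z) (ratio ρ z * s)) =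
      q (z.2 0) * fiberMeasure q f (skew z).1 (Metric.closedBall (f (skew z)) s) := by
  obtain ⟨c, hc⟩ := hf.exists_eq
  have hball : ∀ (x : ℝ) (s : ℝ), MeasurableSet (Metric.closedBall x s) := fun x s =>
    Metric.isClosed_closedBall.measurableSet
  rw [cellMeasure, fiberMeasure, Measure.map_apply (hf.measurable_section _) (hball _ _),
    Measure.map_apply (hf.measurable_section _) (hball _ _),
    Measure.restrict_apply (hf.measurable_section _ (hball _ _)),
    ← bernoulliOneSided_inter_preimage_sigma q (z.2 0) (hf.measurable_section _ (hball _ _))]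
  congr 1
  ext w
  simp only [mem_inter_iff, mem_preimage, mem_ofPred_eq, Metric.mem_closedBall, Real.dist_eq]
  rw [and_comm]
  refine and_congr_right fun hw => ?_
  have h1 : f (z.1, w) - f z = ratio ρ z * (f (sigma z.1, sigma w) - f (skew z)) := by
    rw [hc z, hc (z.1, w)]
    have : ratio ρ (z.1, w) = ratio ρ z := by simp [ratio, hw]
    rw [this]
    simp only [skew]
    ring
  have h0 : 0 < ratio ρ z := (hρ _).1
  rw [h1, abs_mul, abs_of_pos h0, mul_le_mul_iff_right₀ h0]
  rfl

theorem measurable_ballMass (n : ℕ) : Measurable (ballMass ρ R q f n) := by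
  have hset : MeasurableSet {x : (Code × Code) × Code |
      dist (f (x.1.1, x.2)) (f x.1) ≤ radius ρ R n x.1} := by
    refine measurableSet_le (Measurable.dist ?_ ?_) ((measurable_radius n).comp measurable_fst)
    · exact hf.measurable.comp ((measurable_fst.comp measurable_fst).prodMk measurable_snd)
    · exact hf.measurable.comp measurable_fst
  have h := (measurable_measure_prodMk_left (ν := bernoulliOneSided q) hset).ennreal_toReal
  convert h using 2 with z
  rw [ballMass, measureReal_def, fiberMeasure, Measure.map_apply (hf.measurable_section _)
    Metric.isClosed_closedBall.measurableSet]
  rfl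

/-- With initial radius `b - a` the first ball contains the whole fibre, so the telescoping of
logarithms ends in `log 1 = 0`. -/
theorem ballMass_zero (z : Code × Code) : ballMass ρ (b - a) q f 0 z = 1 := by
  have := hf.isProbabilityMeasure_fiberMeasure (q := q) z.1
  have : fiberMeasure q f z.1 (Metric.closedBall (f z) (b - a)) = 1 := by
    rw [fiberMeasure, Measure.map_apply (hf.measurable_section _)
      Metric.isClosed_closedBall.measurableSet]
    convert measure_univ (μ := bernoulliOneSided q)
    refine eq_univ_of_forall fun w => ?_
    have h1 := hf.mem_Icc (z.1, w)
    have h2 := hf.mem_Icc z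
    simp only [mem_preimage, Metric.mem_closedBall, Real.dist_eq]
    exact abs_sub_le_of_le_of_le h1.1 h1.2 h2.1 h2.2
  rw [ballMass, radius, measureReal_def, this, ENNReal.toReal_one]

theorem ballMass_le_one (n : ℕ) (z : Code × Code) : ballMass ρ R q f n z ≤ 1 := by
  have := hf.isProbabilityMeasure_fiberMeasure (q := q) z.1
  exact measureReal_le_one

theorem measurable_ballInfo (n : ℕ) : Measurable (ballInfo ρ R q f n) :=
  (hf.measurable_ballMass (n + 1)).log.sub
    (((measurable_from_top (f := fun j : ℕ+ => (q j).toReal)).comp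
      ((measurable_pi_apply 0).comp measurable_snd)).mul
        ((hf.measurable_ballMass n).comp measurable_skew)).log

/-- The defining form of `ballInfo` telescopes along orbits; this form compares two measures on one
ball and is the one to which differentiation and the maximal inequality apply. -/
theorem ballInfo_eq (hρ : ∀ i, 0 < ρ i ∧ ρ i < r) (n : ℕ) (z : Code × Code) :
    ballInfo ρ R q f n z =
      Real.log ((fiberMeasure q f z.1).real (Metric.closedBall (f z) (radius ρ R (n + 1) z))) -
      Real.log ((cellMeasure q f z.1 (z.2 0)).real
        (Metric.closedBall (f z) (radius ρ R (n + 1) z))) := by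
  have h := congrArg ENNReal.toReal
    (hf.cellMeasure_closedBall (q := q) hρ z (radius ρ R n (skew z)))
  rw [ENNReal.toReal_mul] at h
  rw [ballInfo, measureReal_def (cellMeasure q f z.1 (z.2 0)), radius, h]
  rfl

theorem ae_cell {P : ℕ+ → ℝ → Prop} (l : Code) (h : ∀ j, ∀ᵐ x ∂cellMeasure q f l j, P j x) :
    ∀ᵐ w ∂bernoulliOneSided q, P (w 0) (f (l, w)) := by
  have h1 : ∀ j, ∀ᵐ w ∂bernoulliOneSided q, w 0 = j → P j (f (l, w)) := fun j => by
    have h2 := ae_of_ae_map (hf.measurable_section l).aemeasurable (h j)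
    exact (ae_restrict_iff' (measurableSet_eval_zero j)).1 h2
  filter_upwards [ae_all_iff.2 h1] with w hw
  exact hw _ rfl

omit hf in
theorem isFiniteMeasure_cellMeasure (l : Code) (j : ℕ+) : IsFiniteMeasure (cellMeasure q f l j) := by
  unfold cellMeasure; infer_instance

theorem ae_exists_tendsto_ballInfo (hr : r < 1) (hρ : ∀ i, 0 < ρ i ∧ ρ i < r) (hR : 0 < R)
    (l : Code) :
    ∀ᵐ w ∂bernoulliOneSided q, ∃ L, Tendsto (fun n => ballInfo ρ R q f n (l, w)) atTop (𝓝 L) := by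
  have := hf.isProbabilityMeasure_fiberMeasure (q := q) l
  have := isFiniteMeasure_cellMeasure (f := f) (q := q) l
  filter_upwards [hf.ae_cell l fun j => ae_exists_tendsto_log_sub_log (hf.cellMeasure_le l j)]
    with w ⟨L, hL⟩
  refine ⟨L, ?_⟩
  simp only [hf.ballInfo_eq hρ]
  refine hL.comp (tendsto_nhdsWithin_iff.2 ⟨?_, Eventually.of_forall fun n => ?_⟩)
  · exact (tendsto_radius hr hρ hR (l, w)).comp (tendsto_add_atTop_nat 1)
  · exact radius_pos hρ hR _ _

theorem ae_ballMass_pos (hρ : ∀ i, 0 < ρ i ∧ ρ i < r) (hR : 0 < R) (l : Code) :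
    ∀ᵐ w ∂bernoulliOneSided q, ∀ n, 0 < ballMass ρ R q f n (l, w) := by
  have := hf.isProbabilityMeasure_fiberMeasure (q := q) l
  filter_upwards [ae_of_ae_map (hf.measurable_section l).aemeasurable
    (ae_measureReal_closedBall_pos (fiberMeasure q f l))] with w hw n
  exact hw _ (radius_pos hρ hR n _)

theorem ae_ballInfo_nonneg (hρ : ∀ i, 0 < ρ i ∧ ρ i < r) (hR : 0 < R) (l : Code) :
    ∀ᵐ w ∂bernoulliOneSided q, ∀ n, 0 ≤ ballInfo ρ R q f n (l, w) := by
  have := hf.isProbabilityMeasure_fiberMeasure (q := q) l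
  have := isFiniteMeasure_cellMeasure (f := f) (q := q) l
  filter_upwards [hf.ae_cell l fun j => ae_measureReal_closedBall_pos (cellMeasure q f l j)]
    with w hw n
  rw [hf.ballInfo_eq hρ, sub_nonneg]
  exact Real.log_le_log (hw _ (radius_pos hρ hR _ _))
    (ENNReal.toReal_mono (measure_ne_top _ _) (hf.cellMeasure_le _ _ _))

/-- The cell of first letter `j` contributes at most `-q_j log q_j + N q_j`, with `N` independent of
the fibre and the cell. These bounds are summable because `Q` has finite entropy. -/
theorem lintegral_iSup_ballInfo_lt_top (hr : r < 1) (hρ : ∀ i, 0 < ρ i ∧ ρ i < r) (hR : 0 < R)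
    (p : PMF ℕ+) (hq : Summable fun j => (q j).toReal * Real.log (q j).toReal) :
    ∫⁻ z, ⨆ n, ENNReal.ofReal (ballInfo ρ R q f n z)
      ∂((bernoulliOneSided p).prod (bernoulliOneSided q)) < ⊤ := by
  obtain ⟨N, hN⟩ := exists_lintegral_iSup_log_le (Ω := Code)
  have hm : Measurable fun z => ⨆ n, ENNReal.ofReal (ballInfo ρ R q f n z) :=
    Measurable.iSup fun n => (hf.measurable_ballInfo n).ennreal_ofReal
  set H : ℕ+ → ℝ := fun j => -((q j).toReal * Real.log (q j).toReal) + N * (q j).toReal with hH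
  have hcell : ∀ l j, ∫⁻ w in {w | w 0 = j}, ⨆ n, ENNReal.ofReal (ballInfo ρ R q f n (l, w))
      ∂bernoulliOneSided q ≤ ENNReal.ofReal (H j) := by
    intro l j
    have := hf.isProbabilityMeasure_fiberMeasure (q := q) l
    have hmass : ((bernoulliOneSided q).restrict {w | w 0 = j}).real univ = (q j).toReal := by
      rw [measureReal_def, Measure.restrict_apply_univ, bernoulliOneSided_eval_zero]
    have hcongr : ∀ w ∈ {w : Code | w 0 = j}, ∀ n, ballInfo ρ R q f n (l, w) =
        Real.log ((fiberMeasure q f l).real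
          (Metric.closedBall (f (l, w)) (radius ρ R (n + 1) (l, w)))) -
        Real.log ((cellMeasure q f l j).real
          (Metric.closedBall (f (l, w)) (radius ρ R (n + 1) (l, w)))) := by
      rintro w rfl n
      exact hf.ballInfo_eq hρ n (l, w)
    rcases eq_or_ne (q j) 0 with h0 | h0
    · have : (bernoulliOneSided q).restrict {w | w 0 = j} = 0 := by
        rw [Measure.restrict_eq_zero, bernoulliOneSided_eval_zero, h0]
      rw [this, lintegral_zero_measure]
      exact zero_le
    have hq0 : 0 < (q j).toReal := ENNReal.toReal_pos h0 (q.apply_ne_top j)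
    have hq1 : (q j).toReal ≤ 1 :=
      ENNReal.toReal_le_of_le_ofReal zero_le_one (by simpa using q.coe_le_one j)
    have := hN ((bernoulliOneSided q).restrict {w | w 0 = j}) (fiberMeasure q f l)
      (fun w => f (l, w)) (fun n w => radius ρ R (n + 1) (l, w)) R (hf.measurable_section l)
      (hf.cellMeasure_le l j) (fun n w => radius_pos hρ hR _ _) (fun n w => ?_) (fun n => ?_)
      (by rwa [hmass]) (by rwa [hmass])
    · rw [hmass] at this
      refine (setLIntegral_congr_fun (measurableSet_eval_zero j) fun w hw => ?_).trans_le this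
      simp only [hcongr w hw]
      rfl
    · refine (radius_le hρ hR _ _).trans (mul_le_of_le_one_left hR.le ?_)
      exact pow_le_one₀ ((hρ 1).1.trans (hρ 1).2).le hr.le
    · have := isFiniteMeasure_cellMeasure (f := f) (q := q) l j
      have hx := hf.measurable_section l
      have hs := (measurable_radius (ρ := ρ) (R := R) (n + 1)).comp
        (measurable_prodMk_left (x := l))
      exact (measurable_measureReal_closedBall hx hs).log.sub
        (measurable_measureReal_closedBall (M := cellMeasure q f l j) hx hs).log
  have hcover : (⋃ j : ℕ+, {w : Code | w 0 = j}) = univ := by ext w; simp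
  have hsum : Summable H := by
    refine hq.neg.add (Summable.mul_left _ ?_)
    exact ENNReal.summable_toReal q.tsum_coe_ne_top
  have hH0 : ∀ j, 0 ≤ H j := fun j => by
    have hq1 : (q j).toReal ≤ 1 :=
      ENNReal.toReal_le_of_le_ofReal zero_le_one (by simpa using q.coe_le_one j)
    have := Real.log_nonpos ENNReal.toReal_nonneg hq1
    have h0 : 0 ≤ (q j).toReal := ENNReal.toReal_nonneg
    have : 0 ≤ (N : ℝ) * (q j).toReal := by positivity
    simp only [hH]
    nlinarith
  have hfib : ∀ l, ∫⁻ w, ⨆ n, ENNReal.ofReal (ballInfo ρ R q f n (l, w)) ∂bernoulliOneSided q ≤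
      ENNReal.ofReal (∑' j, H j) := by
    intro l
    rw [ENNReal.ofReal_tsum_of_nonneg hH0 hsum, ← setLIntegral_univ, ← hcover]
    exact (lintegral_iUnion_le _ _).trans (ENNReal.tsum_le_tsum fun j => hcell l j)
  rw [lintegral_prod _ hm.aemeasurable]
  refine (lintegral_mono hfib).trans_lt ?_
  rw [lintegral_const, measure_univ, mul_one]
  exact ENNReal.ofReal_lt_top

end IsFiberProjection

end System

/-! ### Exact dimensionality of the one-sided system -/

section OneSided

variable {ρ : ℕ+ → ℝ} {r : ℝ} {a b R : ℝ} {f : Code × Code → ℝ} {p q : PMF ℕ+}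

theorem map_snd_eval_zero (p q : PMF ℕ+) :
    ((bernoulliOneSided p).prod (bernoulliOneSided q)).map (fun z => z.2 0) = q.toMeasure := by
  rw [show (fun z : Code × Code => z.2 0) = (fun w : Code => w 0) ∘ Prod.snd from rfl,
    ← Measure.map_map (measurable_pi_apply 0) measurable_snd, Measure.map_snd_prod,
    measure_univ, one_smul, map_eval_bernoulliOneSided]

theorem integrable_comp_snd_eval_zero {g : ℕ+ → ℝ} (hg : Summable fun j => (q j).toReal * g j) :
    Integrable (fun z : Code × Code => g (z.2 0))
      ((bernoulliOneSided p).prod (bernoulliOneSided q)) := by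
  have hm : Measurable fun z : Code × Code => z.2 0 :=
    (measurable_pi_apply 0).comp measurable_snd
  have h := (PMF.integrable_toMeasure_iff q g).2 hg
  rw [← map_snd_eval_zero p q] at h
  exact h.comp_measurable hm

theorem integral_comp_snd_eval_zero {g : ℕ+ → ℝ} (hg : Summable fun j => (q j).toReal * g j) :
    ∫ z, g (z.2 0) ∂((bernoulliOneSided p).prod (bernoulliOneSided q)) =
      ∑' j, (q j).toReal * g j := by
  have hm : Measurable fun z : Code × Code => z.2 0 :=
    (measurable_pi_apply 0).comp measurable_snd
  rw [← PMF.integral_toMeasure q hg, ← map_snd_eval_zero p q,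
    integral_map hm.aemeasurable measurable_from_top.aestronglyMeasurable]

theorem integrable_comp_eval_eval {g : ℕ+ → ℝ} (hg : Summable fun j => (p j).toReal * g j) :
    Integrable (fun z : Code × Code => g (z.1 ((z.2 0 : ℕ+) : ℕ)))
      ((bernoulliOneSided p).prod (bernoulliOneSided q)) := by
  have h := (PMF.integrable_toMeasure_iff p g).2 hg
  rw [← map_eval_eval p q] at h
  exact h.comp_measurable measurable_eval_eval

theorem integral_comp_eval_eval {g : ℕ+ → ℝ} (hg : Summable fun j => (p j).toReal * g j) :
    ∫ z, g (z.1 ((z.2 0 : ℕ+) : ℕ)) ∂((bernoulliOneSided p).prod (bernoulliOneSided q)) =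
      ∑' j, (p j).toReal * g j := by
  rw [← PMF.integral_toMeasure p hg, ← map_eval_eval p q,
    integral_map measurable_eval_eval.aemeasurable measurable_from_top.aestronglyMeasurable]

/-- The definition of `ballInfo` is unrolled along the orbit. Positivity along the whole orbit is
needed to split the logarithms of products. -/
theorem log_ballMass_eq (hf : IsFiberProjection ρ a b f) (n : ℕ) {z : Code × Code}
    (hz : ∀ k, q ((skew^[k] z).2 0) ≠ 0 ∧ ∀ n, 0 < ballMass ρ (b - a) q f n (skew^[k] z)) :
    Real.log (ballMass ρ (b - a) q f n z) =
      birkhoffSum skew (fun z => Real.log (q (z.2 0)).toReal) n z +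
        ∑ k ∈ Finset.range n, ballInfo ρ (b - a) q f (n - k - 1) (skew^[k] z) := by
  induction n generalizing z with
  | zero => simp [hf.ballMass_zero]
  | succ n ih =>
    have hz' : ∀ k, q ((skew^[k] (skew z)).2 0) ≠ 0 ∧
        ∀ n, 0 < ballMass ρ (b - a) q f n (skew^[k] (skew z)) := fun k => hz (k + 1)
    have hq0 : (q (z.2 0)).toReal ≠ 0 :=
      (ENNReal.toReal_pos (hz 0).1 (q.apply_ne_top _)).ne'
    have hG0 : ballMass ρ (b - a) q f n (skew z) ≠ 0 := ((hz 1).2 n).ne'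
    rw [Finset.sum_range_succ', birkhoffSum_succ']
    have h1 := ih hz'
    have h2 : ballInfo ρ (b - a) q f (n + 1 - 0 - 1) (skew^[0] z) =
        Real.log (ballMass ρ (b - a) q f (n + 1) z) -
          (Real.log (q (z.2 0)).toReal + Real.log (ballMass ρ (b - a) q f n (skew z))) := by
      rw [← Real.log_mul hq0 hG0]
      rfl
    have h3 : ∀ k ∈ Finset.range n, ballInfo ρ (b - a) q f (n + 1 - (k + 1) - 1) (skew^[k + 1] z) =
        ballInfo ρ (b - a) q f (n - k - 1) (skew^[k] (skew z)) := fun k _ => by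
      rw [Nat.add_sub_add_right, Function.iterate_succ_apply]
    rw [h2, Finset.sum_congr rfl h3, h1]
    ring

/-- The projected measures of balls along the orbit decay at a constant exponential rate. -/
theorem exists_tendsto_log_ballMass_div (hf : IsFiberProjection ρ a b f) (hab : a < b) (hr : r < 1)
    (hρ : ∀ i, 0 < ρ i ∧ ρ i < r) (p : PMF ℕ+)
    (hq : Summable fun j => (q j).toReal * Real.log (q j).toReal) :
    ∃ h : ℝ, 0 ≤ h ∧ h ≤ -∑' j, (q j).toReal * Real.log (q j).toReal ∧
      ∀ᵐ z ∂((bernoulliOneSided p).prod (bernoulliOneSided q)),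
        (∀ n, 0 < ballMass ρ (b - a) q f n z) ∧
        Tendsto (fun n : ℕ => -Real.log (ballMass ρ (b - a) q f n z) / n) atTop (𝓝 h) := by
  set μ := (bernoulliOneSided p).prod (bernoulliOneSided q) with hμ
  have hR : 0 < b - a := sub_pos.2 hab
  set F : ℕ → Code × Code → ℝ := ballInfo ρ (b - a) q f with hF
  have hFm : ∀ n, Measurable (F n) := hf.measurable_ballInfo
  have hpos : ∀ᵐ z ∂μ, ∀ n, 0 < ballMass ρ (b - a) q f n z := by
    have hm : MeasurableSet {z | ∀ n, 0 < ballMass ρ (b - a) q f n z} :=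
      measurableSet_setOfPred.2 (Measurable.forall fun n => measurableSet_setOfPred.1
        (measurableSet_lt measurable_const (hf.measurable_ballMass n)))
    exact (Measure.ae_prod_mem_iff_ae_ae_mem hm).2
      (Eventually.of_forall fun l => hf.ae_ballMass_pos hρ hR l)
  have hq0 : ∀ᵐ z ∂μ, q (z.2 0) ≠ 0 := by
    have h1 : ∀ᵐ j ∂q.toMeasure, q j ≠ 0 := by
      rw [ae_iff_of_countable]
      intro j hj
      rwa [PMF.toMeasure_apply_singleton _ _ (measurableSet_singleton j)] at hj
    rw [← map_snd_eval_zero p q] at h1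
    exact ae_of_ae_map ((measurable_pi_apply 0).comp measurable_snd).aemeasurable h1
  have hnn : ∀ᵐ z ∂μ, ∀ n, 0 ≤ F n z := by
    have hm : MeasurableSet {z | ∀ n, 0 ≤ F n z} :=
      measurableSet_setOfPred.2 (Measurable.forall fun n => measurableSet_setOfPred.1
        (measurableSet_le measurable_const (hFm n)))
    exact (Measure.ae_prod_mem_iff_ae_ae_mem hm).2
      (Eventually.of_forall fun l => hf.ae_ballInfo_nonneg hρ hR l)
  have hconv : ∀ᵐ z ∂μ, ∃ L, Tendsto (fun n => F n z) atTop (𝓝 L) :=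
    (Measure.ae_prod_mem_iff_ae_ae_mem (measurableSet_exists_tendsto hFm)).2
      (Eventually.of_forall fun l => hf.ae_exists_tendsto_ballInfo hr hρ hR l)
  obtain ⟨F', hF'm, hF'⟩ := measurable_limit_of_tendsto_metrizable_ae
    (fun n => (hFm n).aemeasurable) hconv
  set M : Code × Code → ℝ≥0∞ := fun z => ⨆ n, ENNReal.ofReal (F n z) with hM
  have hMm : Measurable M := Measurable.iSup fun n => (hFm n).ennreal_ofReal
  have hMfin : ∫⁻ z, M z ∂μ < ⊤ := hf.lintegral_iSup_ballInfo_lt_top hr hρ hR p hq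
  have hMlt : ∀ᵐ z ∂μ, M z < ⊤ := ae_lt_top hMm hMfin.ne
  have hbound : ∀ᵐ z ∂μ, ∀ n, |F (n - 1) z| ≤ (M z).toReal := by
    filter_upwards [hnn, hMlt] with z h1 h2 n
    rw [abs_of_nonneg (h1 _), ← ENNReal.ofReal_le_iff_le_toReal h2.ne]
    exact le_iSup (fun n => ENNReal.ofReal (F n z)) (n - 1)
  -- The shift to `F (n - 1)` matches the index `n - k - 1` in the telescoped sum; since `k < n`,
  -- the truncated value at `n = 0` never occurs.
  have hmaker := ae_tendsto_sum_antidiagonal_div (ergodic_skew p q) (g := fun n => F (n - 1))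
    (fun n => hFm (n - 1)) hF'm hMm.ennreal_toReal
    (integrable_toReal_of_lintegral_ne_top hMm.aemeasurable hMfin.ne) hbound
    (hF'.mono fun z hz => hz.comp (tendsto_sub_atTop_nat 1))
  have hbirk := ae_tendsto_birkhoffSum_div (ergodic_skew p q)
    ((measurable_from_top (f := fun j : ℕ+ => Real.log (q j).toReal)).comp
      ((measurable_pi_apply 0).comp measurable_snd)) (integrable_comp_snd_eval_zero (p := p) hq)
  rw [← hμ] at hbirk hmaker
  have hint := integral_comp_snd_eval_zero (p := p) hq
  have horb : ∀ᵐ z ∂μ, ∀ k, q ((skew^[k] z).2 0) ≠ 0 ∧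
      ∀ n, 0 < ballMass ρ (b - a) q f n (skew^[k] z) :=
    ae_all_iff.2 fun k => ((ergodic_skew p q).toMeasurePreserving.iterate k).quasiMeasurePreserving.ae
      (hq0.and hpos)
  -- The entropy of `Q` minus the mean limiting information of the first letter given the projected
  -- point.
  set h := -(∑' j, (q j).toReal * Real.log (q j).toReal) - ∫ z, F' z ∂μ with hh
  have hlim : ∀ᵐ z ∂μ,
      Tendsto (fun n : ℕ => -Real.log (ballMass ρ (b - a) q f n z) / n) atTop (𝓝 h) := by
    filter_upwards [hmaker, hbirk, horb] with z h1 h2 h3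
    have h4 := h2.neg.sub h1
    rw [hh, ← hint]
    refine h4.congr fun n => ?_
    rw [log_ballMass_eq hf n h3, neg_add, sub_eq_add_neg, ← neg_div, ← neg_div, ← add_div]
    rfl
  have hF'0 : 0 ≤ ∫ z, F' z ∂μ := by
    refine integral_nonneg_of_ae ?_
    filter_upwards [hnn, hF'] with z h1 h2
    exact ge_of_tendsto' h2 h1
  -- The upper bound comes from `F' ≥ 0` almost everywhere, the lower one from ball masses being at
  -- most `1`.
  refine ⟨h, ?_, by linarith, hpos.and hlim⟩
  obtain ⟨z, hz1, hz2⟩ := (hpos.and hlim).exists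
  refine ge_of_tendsto' hz2 fun n => div_nonneg ?_ (Nat.cast_nonneg n)
  exact neg_nonneg.2 (Real.log_nonpos (hz1 n).le (hf.ballMass_le_one n z))

theorem tendsto_neg_log_radius_div {l : Filter ℝ} (hρ : ∀ i, 0 < ρ i ∧ ρ i < r) (hR : 0 < R)
    {z : Code × Code}
    (h : Tendsto (fun n : ℕ => birkhoffSum skew (fun z => -Real.log (ratio ρ z)) n z / n
      - Real.log R / n) atTop l) :
    Tendsto (fun n : ℕ => -Real.log (radius ρ R n z) / n) atTop l :=
  h.congr fun n => by rw [neg_log_radius hρ hR, sub_div]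

/-- Birkhoff's theorem is applied to the truncations at each `M : ℕ`, whose averages bound the
original ones from below and have unbounded limits. -/
theorem ae_tendsto_birkhoffSum_neg_log_ratio_atTop (hr : r < 1) (hρ : ∀ i, 0 < ρ i ∧ ρ i < r)
    (h : ¬ Summable fun j => (p j).toReal * Real.log (ρ j)) :
    ∀ᵐ z ∂((bernoulliOneSided p).prod (bernoulliOneSided q)),
      Tendsto (fun n : ℕ => birkhoffSum skew (fun z => -Real.log (ratio ρ z)) n z / n) atTop
        atTop := by
  set μ := (bernoulliOneSided p).prod (bernoulliOneSided q) with hμ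
  have hlog : ∀ i, 0 < -Real.log (ρ i) := fun i =>
    neg_pos.2 (Real.log_neg (hρ i).1 ((hρ i).2.trans hr))
  have hmin0 : ∀ (M : ℕ) i, 0 ≤ min (-Real.log (ρ i)) M := fun M i =>
    le_min (hlog i).le (Nat.cast_nonneg M)
  have hsum : ∀ M : ℕ, Summable fun i => (p i).toReal * min (-Real.log (ρ i)) M := fun M => by
    refine Summable.of_nonneg_of_le (fun i => mul_nonneg ENNReal.toReal_nonneg (hmin0 M i))
      (fun i => mul_le_mul_of_nonneg_left (min_le_right _ _) ENNReal.toReal_nonneg)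
      ((ENNReal.summable_toReal p.tsum_coe_ne_top).mul_right (M : ℝ))
  have hbirk : ∀ᵐ z ∂μ, ∀ M : ℕ, Tendsto (fun n : ℕ =>
      birkhoffSum skew (fun z => min (-Real.log (ratio ρ z)) M) n z / n) atTop
        (𝓝 (∑' i, (p i).toReal * min (-Real.log (ρ i)) M)) := by
    refine ae_all_iff.2 fun M => ?_
    have := ae_tendsto_birkhoffSum_div (ergodic_skew p q)
      (f := fun z => min (-Real.log (ratio ρ z)) (M : ℝ))
      (measurable_ratio.log.neg.min measurable_const) (integrable_comp_eval_eval
        (g := fun i => min (-Real.log (ρ i)) (M : ℝ)) (hsum M))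
    rwa [show ∫ z, min (-Real.log (ratio ρ z)) (M : ℝ) ∂_ = _ from
      integral_comp_eval_eval (g := fun i => min (-Real.log (ρ i)) (M : ℝ)) (hsum M)] at this
  -- A uniform bound on the truncated means would bound every finite partial sum, as a large `M`
  -- does not truncate finitely many terms; the series would then converge.
  have hunb : ∀ C : ℝ, ∃ M : ℕ, C < ∑' i, (p i).toReal * min (-Real.log (ρ i)) M := by
    intro C
    by_contra! hC
    refine h ?_
    rw [← summable_neg_iff]
    refine summable_of_sum_le (c := C) (fun i => ?_) fun u => ?_
    · rw [← mul_neg]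
      exact mul_nonneg ENNReal.toReal_nonneg (hlog i).le
    · obtain ⟨M, hM⟩ := exists_nat_ge (∑ i ∈ u, -Real.log (ρ i))
      refine le_trans (Finset.sum_le_sum fun i hi => ?_)
        (((hsum M).sum_le_tsum u fun i _ => mul_nonneg ENNReal.toReal_nonneg (hmin0 M i)).trans
          (hC M))
      have h1 : -Real.log (ρ i) ≤ M :=
        (Finset.single_le_sum (f := fun i => -Real.log (ρ i)) (fun i _ => (hlog i).le) hi).trans hM
      rw [min_eq_left h1, mul_neg]
  filter_upwards [hbirk] with z hz
  refine tendsto_atTop.2 fun C => ?_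
  obtain ⟨M, hM⟩ := hunb C
  filter_upwards [(hz M).eventually_const_lt hM] with n hn
  refine hn.le.trans (div_le_div_of_nonneg_right ?_ (Nat.cast_nonneg n))
  exact Finset.sum_le_sum fun k _ => min_le_left _ _

theorem ae_tendsto_birkhoffSum_neg_log_ratio
    (h : Summable fun j => (p j).toReal * Real.log (ρ j)) :
    ∀ᵐ z ∂((bernoulliOneSided p).prod (bernoulliOneSided q)),
      Tendsto (fun n : ℕ => birkhoffSum skew (fun z => -Real.log (ratio ρ z)) n z / n) atTop
        (𝓝 (-∑' j, (p j).toReal * Real.log (ρ j))) := by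
  have h' : Summable fun j => (p j).toReal * -Real.log (ρ j) := by simpa using h.neg
  have := ae_tendsto_birkhoffSum_div (ergodic_skew p q)
    (f := fun z => -Real.log (ratio ρ z)) measurable_ratio.log.neg (integrable_comp_eval_eval
      (g := fun i => -Real.log (ρ i)) h')
  rw [show ∫ z, -Real.log (ratio ρ z) ∂_ = _ from
    integral_comp_eval_eval (g := fun i => -Real.log (ρ i)) h'] at this
  simpa [tsum_neg] using this

theorem tsum_mul_log_neg (hr : r < 1) (hρ : ∀ i, 0 < ρ i ∧ ρ i < r)
    (h : Summable fun j => (p j).toReal * Real.log (ρ j)) :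
    ∑' j, (p j).toReal * Real.log (ρ j) < 0 := by
  have hlog : ∀ i, Real.log (ρ i) < 0 := fun i => Real.log_neg (hρ i).1 ((hρ i).2.trans hr)
  obtain ⟨i, hi⟩ := p.support_nonempty
  have h' : Summable fun j => (p j).toReal * -Real.log (ρ j) := by simpa using h.neg
  have := h'.tsum_pos (fun j => mul_nonneg ENNReal.toReal_nonneg (neg_nonneg.2 (hlog j).le)) i
    (mul_pos (ENNReal.toReal_pos hi (p.apply_ne_top i)) (neg_pos.2 (hlog i)))
  simp only [mul_neg, tsum_neg] at this
  linarith

theorem tsum_mul_log_nonpos (p : PMF ℕ+) : ∑' j, (p j).toReal * Real.log (p j).toReal ≤ 0 :=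
  tsum_nonpos fun j => mul_nonpos_of_nonneg_of_nonpos ENNReal.toReal_nonneg
    (Real.log_nonpos ENNReal.toReal_nonneg
      (ENNReal.toReal_le_of_le_ofReal zero_le_one (by simpa using p.coe_le_one j)))

/-- The fibre measures of a random system of similarities driven by Bernoulli measures have a
constant pointwise dimension, bounded by the ratio of entropy and Lyapunov exponent. -/
theorem exists_ae_hasPointwiseDim_fiberMeasure (hf : IsFiberProjection ρ a b f) (hab : a < b)
    (hr : r < 1) (hρ : ∀ i, 0 < ρ i ∧ ρ i < r) (p : PMF ℕ+)
    (hq : Summable fun j => (q j).toReal * Real.log (q j).toReal) :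
    ∃ d : ℝ, (∀ᵐ z ∂((bernoulliOneSided p).prod (bernoulliOneSided q)),
        HasPointwiseDim (fiberMeasure q f z.1) (f z) d) ∧ 0 ≤ d ∧
      ((Summable fun j => (p j).toReal * Real.log (ρ j)) →
        d ≤ (∑' j, (q j).toReal * Real.log (q j).toReal) / ∑' j, (p j).toReal * Real.log (ρ j)) ∧
      ((¬ Summable fun j => (p j).toReal * Real.log (ρ j)) → d = 0) := by
  obtain ⟨h, hh0, hhle, hmass⟩ := exists_tendsto_log_ballMass_div hf hab hr hρ p hq
  have hR : 0 < b - a := sub_pos.2 hab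
  -- Used with `l` the neighbourhood filter of the Lyapunov exponent and with `l = atTop` when the
  -- exponent is infinite.
  have key : ∀ (l : Filter ℝ) (d : ℝ), Tendsto (fun x : ℝ × ℝ => x.1 / x.2) (𝓝 h ×ˢ l) (𝓝 d) →
      (∀ᵐ z ∂((bernoulliOneSided p).prod (bernoulliOneSided q)), Tendsto (fun n : ℕ =>
        -Real.log (radius ρ (b - a) n z) / n) atTop l) →
      ∀ᵐ z ∂((bernoulliOneSided p).prod (bernoulliOneSided q)),
        HasPointwiseDim (fiberMeasure q f z.1) (f z) d := by
    intro l d hdiv hl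
    filter_upwards [hmass, hl] with z ⟨h1, h2⟩ h3
    have := hf.isProbabilityMeasure_fiberMeasure (q := q) z.1
    refine hasPointwiseDim_of_tendsto_div (fun n => radius_pos hρ hR n z)
      (antitone_nat_of_succ_le fun n => radius_succ_le hr hρ hR n z) (tendsto_radius hr hρ hR z)
      h1 (fun n => hf.ballMass_le_one n z) (fun n r hlt hle => ⟨?_, ?_⟩) h2 h3 hdiv
    · exact measureReal_mono (Metric.closedBall_subset_ball hlt)
    · exact measureReal_mono (Metric.ball_subset_closedBall.trans (Metric.closedBall_subset_closedBall hle))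
  have hconst : Tendsto (fun n : ℕ => Real.log (b - a) / n) atTop (𝓝 0) :=
    tendsto_const_div_atTop_nhds_zero_nat _
  by_cases hs : Summable fun j => (p j).toReal * Real.log (ρ j)
  · have hneg := tsum_mul_log_neg hr hρ hs
    refine ⟨h / -∑' j, (p j).toReal * Real.log (ρ j), key _ _
      (tendsto_div_prod_nhds (neg_pos.2 hneg).ne') ?_, div_nonneg hh0 (neg_pos.2 hneg).le,
      fun _ => ?_, fun hs' => absurd hs hs'⟩
    · filter_upwards [ae_tendsto_birkhoffSum_neg_log_ratio hs] with z hz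
      have := hz.sub hconst
      rw [sub_zero] at this
      exact tendsto_neg_log_radius_div hρ hR this
    · rw [← neg_div_neg_eq (∑' j, (q j).toReal * Real.log (q j).toReal)]
      exact div_le_div_of_nonneg_right hhle (neg_pos.2 hneg).le
  · refine ⟨0, key atTop 0 tendsto_div_prod_atTop ?_, le_rfl, fun hs' => absurd hs' hs,
      fun _ => rfl⟩
    filter_upwards [ae_tendsto_birkhoffSum_neg_log_ratio_atTop hr hρ hs] with z hz
    refine tendsto_neg_log_radius_div hρ hR ?_
    simpa only [sub_eq_add_neg] using hz.atTop_add hconst.neg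

end OneSided

/-! ### The projection of the two-sided system -/

section Projection

variable {ρ : ℕ+ → ℝ} {r a b : ℝ}

/-- The maps read only `λ_0` and `λ_n` with `n ≥ 1`, and `theta` shifts to the left, so negative
indices never matter. This permits the passage to one-sided sequences. -/
theorem wordMap_congr {l l' : Param} (h : ∀ k : ℕ, l k = l' k) (n : ℕ) (w : Code) :
    wordMap ρ n l w = wordMap ρ n l' w := by
  induction n generalizing l l' w with
  | zero => rfl
  | succ n ih =>
    have h0 : l 0 = l' 0 := h 0
    have hc : contraction ρ l (w 0) = contraction ρ l' (w 0) := by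
      funext x
      simp only [contraction, h, h0]
    rw [wordMap, wordMap, hc, ih (l := theta l) (l' := theta l') fun k => h (k + 1)]

theorem proj_congr {l l' : Param} (h : ∀ k : ℕ, l k = l' k) (X : Set ℝ) (w : Code) :
    proj ρ X l w = proj ρ X l' w := by
  simp only [proj, wordMap_congr h]

/-- Extends a one-sided sequence to a two-sided one. -/
def extend (l : Code) : Param := fun i => l i.toNat

theorem measurable_extend : Measurable extend :=
  measurable_pi_lambda _ fun i => measurable_pi_apply i.toNat

theorem measurable_theta : Measurable theta :=
  measurable_pi_lambda _ fun i => measurable_pi_apply (i + 1)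

theorem measurable_wordMap_uncurry (ρ : ℕ+ → ℝ) (n : ℕ) (x : ℝ) :
    Measurable fun z : Param × Code => wordMap ρ n z.1 z.2 x := by
  induction n with
  | zero => exact measurable_const
  | succ n ih =>
    have h1 : Measurable fun z : Param × ℕ+ => ρ (z.1 ((z.2 : ℕ) : ℤ)) :=
      measurable_from_prod_countable_left fun j =>
        (measurable_from_top (f := ρ)).comp (measurable_pi_apply ((j : ℕ) : ℤ))
    have h2 : Measurable fun z : Param × Code => ρ (z.1 (((z.2 0 : ℕ+) : ℕ) : ℤ)) :=
      h1.comp (measurable_fst.prodMk ((measurable_pi_apply 0).comp measurable_snd))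
    have h3 : Measurable fun z : Param × Code => (-1 : ℝ) ^ ((z.1 0 : ℕ+) : ℕ) :=
      (measurable_from_top (f := fun j : ℕ+ => (-1 : ℝ) ^ (j : ℕ))).comp
        ((measurable_pi_apply 0).comp measurable_fst)
    exact (h2.mul (ih.comp ((measurable_theta.comp measurable_fst).prodMk
      (measurable_sigma.comp measurable_snd)))).add h3

theorem proj_mem_iInter (hr : r < 1) (hρ : ∀ i, 0 < ρ i ∧ ρ i < r) (hab : a < b)
    (hX : ∀ l n, MapsTo (contraction ρ l n) (Icc a b) (Icc a b)) (l : Param) (w : Code) :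
    proj ρ (Icc a b) l w ∈ ⋂ n : ℕ, wordMap ρ (n + 1) l w '' Icc a b := by
  rw [iInter_eq_singleton hr hρ isCompact_Icc (nonempty_Icc.2 hab.le) hX l w]
  exact mem_singleton _

theorem proj_mem_Icc (hr : r < 1) (hρ : ∀ i, 0 < ρ i ∧ ρ i < r) (hab : a < b)
    (hX : ∀ l n, MapsTo (contraction ρ l n) (Icc a b) (Icc a b)) (l : Param) (w : Code) :
    proj ρ (Icc a b) l w ∈ Icc a b :=
  (mapsTo_wordMap hX 1 l w).image_subset (mem_iInter.1 (proj_mem_iInter hr hρ hab hX l w) 0)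

/-- The right-hand side belongs to all the nested images, whose intersection is a single point. -/
theorem proj_eq_contraction (hr : r < 1) (hρ : ∀ i, 0 < ρ i ∧ ρ i < r) (hab : a < b)
    (hX : ∀ l n, MapsTo (contraction ρ l n) (Icc a b) (Icc a b)) (l : Param) (w : Code) :
    proj ρ (Icc a b) l w = contraction ρ l (w 0) (proj ρ (Icc a b) (theta l) (sigma w)) := by
  have hmem : contraction ρ l (w 0) (proj ρ (Icc a b) (theta l) (sigma w)) ∈
      ⋂ n : ℕ, wordMap ρ (n + 1) l w '' Icc a b := by
    refine mem_iInter.2 fun n => image_wordMap_succ_subset hX (n + 1) l w ?_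
    obtain ⟨x, hx, hx'⟩ := mem_iInter.1 (proj_mem_iInter hr hρ hab hX (theta l) (sigma w)) n
    exact ⟨x, hx, by rw [← hx']; rfl⟩
  rw [iInter_eq_singleton hr hρ isCompact_Icc (nonempty_Icc.2 hab.le) hX l w] at hmem
  exact (mem_singleton_iff.1 hmem).symm

theorem tendsto_wordMap (hr : r < 1) (hρ : ∀ i, 0 < ρ i ∧ ρ i < r) (hab : a < b)
    (hX : ∀ l n, MapsTo (contraction ρ l n) (Icc a b) (Icc a b)) (l : Param) (w : Code) :
    Tendsto (fun n : ℕ => wordMap ρ (n + 1) l w a) atTop (𝓝 (proj ρ (Icc a b) l w)) := by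
  have hlim : Tendsto (fun n : ℕ => r ^ (n + 1) * (b - a)) atTop (𝓝 0) := by
    simpa using ((tendsto_pow_atTop_nhds_zero_of_lt_one ((hρ 1).1.trans (hρ 1).2).le hr).comp
      (tendsto_add_atTop_nat 1)).mul_const (b - a)
  refine tendsto_iff_dist_tendsto_zero.2 (squeeze_zero (fun _ => dist_nonneg) (fun n => ?_) hlim)
  obtain ⟨x, hx, hx'⟩ := mem_iInter.1 (proj_mem_iInter hr hρ hab hX l w) n
  rw [← hx', Real.dist_eq]
  refine (abs_wordMap_sub_le hρ _ l w a x).trans (mul_le_mul_of_nonneg_left ?_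
    (pow_nonneg ((hρ 1).1.trans (hρ 1).2).le _))
  exact abs_sub_le_of_le_of_le le_rfl hab.le hx.1 hx.2

theorem isFiberProjection_proj (hr : r < 1) (hρ : ∀ i, 0 < ρ i ∧ ρ i < r) (hab : a < b)
    (hX : ∀ l n, MapsTo (contraction ρ l n) (Icc a b) (Icc a b)) :
    IsFiberProjection ρ a b fun z => proj ρ (Icc a b) (extend z.1) z.2 where
  measurable :=
    measurable_of_tendsto_metrizable
      (fun n => (measurable_wordMap_uncurry ρ (n + 1) a).comp
        ((measurable_extend.comp measurable_fst).prodMk measurable_snd))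
      (tendsto_pi_nhds.2 fun z => tendsto_wordMap hr hρ hab hX (extend z.1) z.2)
  mem_Icc z := proj_mem_Icc hr hρ hab hX _ _
  exists_eq := by
    refine ⟨fun l => (-1) ^ ((l 0 : ℕ+) : ℕ), fun z => ?_⟩
    rw [proj_eq_contraction hr hρ hab hX, contraction]
    have h : ∀ k : ℕ, theta (extend z.1) k = extend (sigma z.1) k := fun k => rfl
    rw [proj_congr h]
    rfl

theorem proj_extend_future (X : Set ℝ) (l : Param) (w : Code) :
    proj ρ X (extend (future l)) w = proj ρ X l w :=
  proj_congr (l := extend (future l)) (l' := l) (fun _ => rfl) X w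

/-- The constant kernel also disintegrates the product measure, and disintegrations are almost
everywhere unique. -/
theorem ae_condKernel_eq {p q : PMF ℕ+} {κ : Kernel Param Code} [IsMarkovKernel κ]
    (h : ((bernoulliTwoSided p).prod (bernoulliOneSided q)).IsCondKernel κ) :
    ∀ᵐ l ∂bernoulliTwoSided p, κ l = bernoulliOneSided q := by
  have h1 := h.disintegrate
  rw [Measure.fst_prod, ← Measure.compProd_const] at h1
  exact Kernel.ae_eq_of_compProd_eq h1

end Projection

end RandomIFS

/-! ### Return to the two-sided system -/

theorem mainTheorem7
    -- the contraction ratios, bounded away from 1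
    (ρ : ℕ+ → ℝ) (r : ℝ) (hr : r < 1) (hρ : ∀ i, 0 < ρ i ∧ ρ i < r)
    -- the compact interval on which the system acts
    (a b : ℝ) (hab : a < b)
    (hX : ∀ (l : RandomIFS.Param) (n : ℕ+),
      MapsTo (RandomIFS.contraction ρ l n) (Icc a b) (Icc a b))
    -- the probability vectors, of finite entropy
    (p q : PMF ℕ+)
    (hp : Summable fun i => (p i).toReal * Real.log (p i).toReal)
    (hq : Summable fun j => (q j).toReal * Real.log (q j).toReal)
    -- the invariant measure `μ = m_P × ν_Q` and its disintegration `(μ_λ)` over `Λ`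
    (μ : Measure (RandomIFS.Param × RandomIFS.Code))
    (hμ : μ = (RandomIFS.bernoulliTwoSided p).prod (RandomIFS.bernoulliOneSided q))
    (κ : Kernel RandomIFS.Param RandomIFS.Code) (hκ : IsMarkovKernel κ)
    (hκμ : μ.IsCondKernel κ) :
    ∃ d : ℝ,
      (∀ᵐ l ∂(RandomIFS.bernoulliTwoSided p),
        RandomIFS.IsExactDimensional ((κ l).map (RandomIFS.proj ρ (Icc a b) l)) d ∧
        RandomIFS.HasHausdorffDim ((κ l).map (RandomIFS.proj ρ (Icc a b) l)) (ENNReal.ofReal d) ∧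
        RandomIFS.HasPackingDim ((κ l).map (RandomIFS.proj ρ (Icc a b) l)) (ENNReal.ofReal d)) ∧
      (∀ᵐ z ∂μ,
        RandomIFS.HasPointwiseDim ((κ z.1).map (RandomIFS.proj ρ (Icc a b) z.1))
          (RandomIFS.proj ρ (Icc a b) z.1 z.2) d) ∧
      0 ≤ d ∧
      -- the upper bound; its denominator is either a negative number or `-∞`
      ((Summable fun j => (p j).toReal * Real.log (ρ j)) →
        d ≤ (∑' i, (p i).toReal * Real.log (p i).toReal
              + ∑' j, (q j).toReal * Real.log (q j).toReal)
            / ∑' j, (p j).toReal * Real.log (ρ j)) ∧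
      ((¬ Summable fun j => (p j).toReal * Real.log (ρ j)) → d = 0) := by
  subst hμ
  have hf := RandomIFS.isFiberProjection_proj hr hρ hab hX
  obtain ⟨d, hd, hd0, hdle, hdzero⟩ :=
    RandomIFS.exists_ae_hasPointwiseDim_fiberMeasure hf hab hr hρ p hq
  have hκae := RandomIFS.ae_condKernel_eq hκμ
  have hpt : ∀ᵐ z ∂(RandomIFS.bernoulliTwoSided p).prod (RandomIFS.bernoulliOneSided q),
      RandomIFS.HasPointwiseDim ((κ z.1).map (RandomIFS.proj ρ (Icc a b) z.1))
        (RandomIFS.proj ρ (Icc a b) z.1 z.2) d := by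
    -- The one-sided result is pulled back along the measure-preserving map that forgets the
    -- negative coordinates of `λ`.
    filter_upwards [((RandomIFS.measurePreserving_future p).prod
      (MeasurePreserving.id (RandomIFS.bernoulliOneSided q))).quasiMeasurePreserving.ae hd,
      Measure.quasiMeasurePreserving_fst.ae hκae] with z h1 h2
    simp only [Prod.map, id, RandomIFS.fiberMeasure, RandomIFS.proj_extend_future] at h1
    rwa [h2]
  refine ⟨d, ?_, hpt, hd0, fun hs => (hdle hs).trans ?_, hdzero⟩
  · filter_upwards [Measure.ae_ae_of_ae_prod hpt, hκae] with l hl hκl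
    have hm : Measurable (RandomIFS.proj ρ (Icc a b) l) :=
      RandomIFS.measurable_proj hr hρ isCompact_Icc (nonempty_Icc.2 hab.le) hX l
    rw [← hκl] at hl
    have hae := RandomIFS.ae_map_hasPointwiseDim hm hl
    have : IsProbabilityMeasure ((κ l).map (RandomIFS.proj ρ (Icc a b) l)) :=
      Measure.isProbabilityMeasure_map hm.aemeasurable
    exact ⟨⟨inferInstance, hae⟩, RandomIFS.hasHausdorffDim_and_hasPackingDim hd0 hae⟩
  -- The bound with the entropy of `Q` alone is already available; adding `∑ p_i log p_i ≤ 0` to the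
  -- numerator over a negative denominator only enlarges the quotient.
  · refine div_le_div_of_nonpos_of_le (RandomIFS.tsum_mul_log_neg hr hρ hs).le ?_
    linarith [RandomIFS.tsum_mul_log_nonpos p]
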